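/- All digraphs are finite and nonempty, have no loops and no multiple arcs. For a strongly connected digraph $\Gamma$ let $\partial_\Gamma(x,y)$ be the length of a shortest path from $x$ to $y$, let the diameter be the maximum of $\partial_\Gamma$, let $\tilde\partial_\Gamma(x,y)=(\partial_\Gamma(x,y),\partial_\Gamma(y,x))$, and let $\tilde\partial(\Gamma)$ be the set of all values $\tilde\partial_\Gamma(x,y)$ with $x,y\in V(\Gamma)$. A strongly connected digraph $\Gamma$ is weakly distance-regular if for all $\tilde h,\tilde i,\tilde j\in\tilde\partial(\Gamma)$ the number of $z$ with $\tilde\partial_\Gamma(x,z)=\tilde i$ and $\tilde\partial_\Gamma(z,y)=\tilde j$ is the same number $p_{\tilde i,\tilde j}^{\tilde h}(\Gamma)$ (an intersection number) for all $x,y$ with $\tilde\partial_\Gamma(x,y)=\tilde h$; it is commutative if $p_{\tilde i,\tilde j}^{\tilde h}(\Gamma)=p_{\tilde j,\tilde i}^{\tilde h}(\Gamma)$ always. A digraph is semicomplete if any two distinct vertices are joined by at least one arc, and locally semicomplete if the out-neighbourhood $N^+(x)$ and the in-neighbourhood $N^-(x)$ of each vertex $x$ induce semicomplete digraphs. For digraphs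 $\Delta$ and $(\Sigma_x)_{x\in V(\Delta)}$, the generalized lexicographic product $\Delta\circ(\Sigma_x)_{x\in V(\Delta)}$ has as vertices the pairs $(x,u)$ with $x\in V(\Delta)$, $u\in V(\Sigma_x)$, and an arc from $(x,u)$ to $(y,v)$ iff $(x,y)$ is an arc of $\Delta$, or $x=y$ and $(u,v)$ is an arc of $\Sigma_x$; it is written $\Delta\circ\Sigma$ if all $\Sigma_x$ equal $\Sigma$. $K_m$ is the complete graph on $m$ vertices, and $\mathrm{Cay}(\mathbb Z_n,S)$ has vertex set $\mathbb Z_n$ and arcs $(x,x+s)$, $s\in S$. An $(r,m)$-team tournament is obtained from the complete multipartite graph with $r$ independent sets $V_1,\dots,V_r$ of size $m$ by replacing each edge $\{x,y\}$ by exactly one of the arcs $(x,y)$, $(y,x)$. It is doubly regular with parameters $(\alpha,\beta,\gamma)$ if all in- and out-valencies are equal to one number and its adjacency matrix $A$ satisfies $A^2=\alpha A+\beta A^t+\gamma(J-I-A-A^t)$, where $J$ is the all-ones matrix; it is then of type II if $\beta-\alpha=0$, $m$ is even and $|N^+(x)\cap V_i|=m/2$ for all $i$ and all $x\notin V_i$.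 **Theorem.** Let $\Gamma$ be a commutative weakly distance-regular digraph. Then $\Gamma$ is locally semicomplete but not semicomplete if and only if $\Gamma$ is isomorphic to one of the following digraphs: 1. $\Lambda\circ K_m$, where $m\ge1$ and $\Lambda$ is a doubly regular $(r,2)$-team tournament of type II for a positive integer $r$ with $4\mid r$; 2. $\mathrm{Cay}(\mathbb Z_{il},\{1,i\})\circ K_m$, where $i\in\{1,2\}$, $l\ge5-i$ and $m\ge1$; 3. $\mathrm{Cay}(\mathbb Z_{iq},\{1,i\})\circ(\Sigma_x)_{x\in\mathbb Z_{iq}}$, where $i\in\{1,2\}$, $q\ge4$, and the $\Sigma_x$ are semicomplete weakly distance-regular digraphs of diameter $2$ with $\tilde\partial(\Sigma_x)=\tilde\partial(\Sigma_0)$ and $p_{\tilde i,\tilde j}^{\tilde h}(\Sigma_0)=p_{\tilde i,\tilde j}^{\tilde h}(\Sigma_x)$ for all $x$ and all $\tilde h,\tilde i,\tilde j\in\tilde\partial(\Sigma_0)$. -/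

import Mathlib

/-! Digraphs are Mathlib's `Digraph V`. The digraphs considered here are finite, nonempty and have no
loops; these conditions are stated explicitly wherever they are needed. -/

universe u

namespace Digraph

/-- There are no arcs `(x, x)`. -/
def Loopless {V : Type*} (Γ : Digraph V) : Prop := ∀ x, ¬ Γ.Adj x x

/-- Isomorphisms of digraphs: bijections preserving and reflecting arcs. -/
abbrev Iso {V W : Type*} (Γ : Digraph V) (Δ : Digraph W) := Γ.Adj ≃r Δ.Adj

/-- The set of out-neighbours of `x`. -/
def outNbhd {V : Type*} (Γ : Digraph V) (x : V) : Set V := {y | Γ.Adj x y}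

/-- The set of in-neighbours of `x`. -/
def inNbhd {V : Type*} (Γ : Digraph V) (x : V) : Set V := {y | Γ.Adj y x}

/-- The subdigraph induced by a set of vertices. -/
def induce {V : Type*} (Γ : Digraph V) (U : Set V) : Digraph U where
  Adj x y := Γ.Adj x y

/-- Any two distinct vertices are joined by at least one arc. -/
def IsSemicomplete {V : Type*} (Γ : Digraph V) : Prop :=
  ∀ x y, x ≠ y → Γ.Adj x y ∨ Γ.Adj y x

/-- All out-neighbourhoods and all in-neighbourhoods induce semicomplete digraphs. -/
def IsLocallySemicomplete {V : Type*} (Γ : Digraph V) : Prop :=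
  ∀ x, (Γ.induce (Γ.outNbhd x)).IsSemicomplete ∧ (Γ.induce (Γ.inNbhd x)).IsSemicomplete

/-- There is a path `x = w 0, w 1, …, w r = y` of length `r` from `x` to `y`
(vertices may repeat). -/
def HasPath {V : Type*} (Γ : Digraph V) (r : ℕ) (x y : V) : Prop :=
  ∃ w : Fin (r + 1) → V, w 0 = x ∧ w (Fin.last r) = y ∧
    ∀ t : Fin r, Γ.Adj (w t.castSucc) (w t.succ)

/-- Every vertex can be reached from every vertex. -/
def IsStronglyConnected {V : Type*} (Γ : Digraph V) : Prop :=
  ∀ x y, ∃ r, Γ.HasPath r x y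

/-- The distance from `x` to `y`: the length of a shortest path. It is used for strongly connected
digraphs only, where such a path exists. -/
noncomputable def dist {V : Type*} (Γ : Digraph V) (x y : V) : ℕ :=
  sInf {r | Γ.HasPath r x y}

/-- `d` is the diameter, that is, the maximum value of the distance function. -/
def HasDiameter {V : Type*} (Γ : Digraph V) (d : ℕ) : Prop :=
  IsGreatest {n | ∃ x y, Γ.dist x y = n} d

/-- The two-way distance from `x` to `y`. -/
noncomputable def twoWayDist {V : Type*} (Γ : Digraph V) (x y : V) : ℕ × ℕ :=
  (Γ.dist x y, Γ.dist y x)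

/-- The two-way distance set. -/
def twoWayDistSet {V : Type*} (Γ : Digraph V) : Set (ℕ × ℕ) :=
  {h | ∃ x y, Γ.twoWayDist x y = h}

/-- For all `x`, `y` at two-way distance `h`, exactly `p` vertices `z` are at two-way distance `i`
from `x` and have `y` at two-way distance `j`. For an attained `h` this says that the intersection
number with upper index `h` and lower indices `i`, `j` exists and equals `p`. -/
def IsIntersectionNumber {V : Type*} (Γ : Digraph V) (h i j : ℕ × ℕ) (p : ℕ) : Prop :=
  ∀ x y, Γ.twoWayDist x y = h → {z | Γ.twoWayDist x z = i ∧ Γ.twoWayDist z y = j}.ncard = p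

/-- Weakly distance-regular digraphs. -/
def IsWeaklyDistanceRegular {V : Type*} (Γ : Digraph V) : Prop :=
  Γ.IsStronglyConnected ∧
    ∀ h ∈ Γ.twoWayDistSet, ∀ i ∈ Γ.twoWayDistSet, ∀ j ∈ Γ.twoWayDistSet,
      ∃ p, Γ.IsIntersectionNumber h i j p

/-- Commutativity of a weakly distance-regular digraph. -/
def IsCommutative {V : Type*} (Γ : Digraph V) : Prop :=
  ∀ h ∈ Γ.twoWayDistSet, ∀ i ∈ Γ.twoWayDistSet, ∀ j ∈ Γ.twoWayDistSet,
    ∀ p, Γ.IsIntersectionNumber h i j p ↔ Γ.IsIntersectionNumber h j i p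

/-- Two weakly distance-regular digraphs have the same two-way distance set and the same
intersection numbers. -/
def SameIntersectionNumbers {V W : Type*} (Γ : Digraph V) (Δ : Digraph W) : Prop :=
  Γ.twoWayDistSet = Δ.twoWayDistSet ∧
    ∀ h ∈ Γ.twoWayDistSet, ∀ i ∈ Γ.twoWayDistSet, ∀ j ∈ Γ.twoWayDistSet,
      ∀ p, Γ.IsIntersectionNumber h i j p ↔ Δ.IsIntersectionNumber h i j p

/-- The complete digraph (no loops; Mathlib's `⊤ : Digraph V` has loops). -/
def completeLoopless (V : Type*) : Digraph V where
  Adj x y := x ≠ y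

/-- The Cayley digraph of an additive group: arcs `(x, x + s)` with `s ∈ S`. -/
def addCayley {G : Type*} [AddGroup G] (S : Set G) : Digraph G where
  Adj x y := -x + y ∈ S

/-- The generalized lexicographic product: `(x, a)` is adjacent to `(y, b)` iff `x` is adjacent to
`y` in `Γ`, or `x = y` and `a` is adjacent to `b` in `S x`. -/
def genLex {V : Type*} {F : V → Type*} (Γ : Digraph V) (S : ∀ x, Digraph (F x)) :
    Digraph (Σ x, F x) where
  Adj := Sigma.Lex Γ.Adj (fun x => (S x).Adj)

/-- The lexicographic product. -/
def lex {V W : Type*} (Γ : Digraph V) (S : Digraph W) : Digraph (Σ _ : V, W) :=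
  Γ.genLex (fun _ => S)

/-- All vertices have exactly `k` out-neighbours and exactly `k` in-neighbours. -/
def IsRegularOfValency {V : Type*} (Γ : Digraph V) (k : ℕ) : Prop :=
  ∀ x, (Γ.outNbhd x).ncard = k ∧ (Γ.inNbhd x).ncard = k

open Classical in
/-- The adjacency matrix, with integer entries. -/
noncomputable def adjacencyMatrix {V : Type*} (Γ : Digraph V) : Matrix V V ℤ :=
  Matrix.of fun x y => if Γ.Adj x y then 1 else 0

/-- `Γ` is an `(r, m)`-team tournament whose `r` independent sets of size `m` are the fibres
of `part`. -/
structure IsTeamTournament {V : Type*} (Γ : Digraph V) (r m : ℕ) (part : V → Fin r) : Prop where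
  ncard_fibre : ∀ i, (part ⁻¹' {i}).ncard = m
  not_adj : ∀ x y, part x = part y → ¬ Γ.Adj x y
  xor_adj : ∀ x y, part x ≠ part y → Xor (Γ.Adj x y) (Γ.Adj y x)

open Classical in
/-- `Γ` is a doubly regular `(r, m)`-team tournament with parameters `(α, β, γ)`. -/
structure IsDoublyRegularTeamTournament {V : Type*} [Fintype V] (Γ : Digraph V) (r m : ℕ)
    (part : V → Fin r) (α β γ : ℤ) : Prop where
  isTeamTournament : Γ.IsTeamTournament r m part
  regular : ∃ k, Γ.IsRegularOfValency k
  sq_eq : Γ.adjacencyMatrix ^ 2 =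
    α • Γ.adjacencyMatrix + β • Γ.adjacencyMatrix.transpose +
      γ • (Matrix.of (fun _ _ => 1) - 1 - Γ.adjacencyMatrix - Γ.adjacencyMatrix.transpose)

/-- `Γ` is a doubly regular `(r, m)`-team tournament of type II. -/
def IsDoublyRegularTeamTournamentTypeII {V : Type*} [Fintype V] (Γ : Digraph V) (r m : ℕ) : Prop :=
  ∃ (part : V → Fin r) (α β γ : ℤ), Γ.IsDoublyRegularTeamTournament r m part α β γ ∧
    β - α = 0 ∧ Even m ∧
    ∀ x i, part x ≠ i → (Γ.outNbhd x ∩ part ⁻¹' {i}).ncard = m / 2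

end Digraph

open scoped Classical Finset

namespace Digraph

/-! ### Paths and distances. -/

section Basic

variable {V : Type*} {Γ : Digraph V} {x y z : V} {r : ℕ}

/-! Call two vertices twins if they have the same closed neighbourhood in the underlying graph.
Closed neighbourhoods have constant size, so twinness is a count of common neighbours and depends
only on the two-way distance. In a locally semicomplete `Γ`, vertices joined by arcs in both
directions are twins, and arcs between distinct twin classes run between all representatives
(`adj_of_isTwin_left`, `adj_of_isTwin_right`). Hence `Γ` is a generalized lexicographic product of
its twin quotient `Δ` with its twin classes, and `Δ` is again weakly distance-regular, oriented and
locally a tournament.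

For such a `Δ` of valency `k` having an arc, `classification` rests on antipodes: each `x` has a
unique `σ x` whose in-neighbours are the out-neighbours of `x` (`exists_antipode`, `eq_antipode`).
For `k = 1` the digraph is a directed cycle. For `k = 2` it is `Cay(ℤ_n, {1, 2})`, where regularity
forces `n` to be even. For `k ≥ 3` the distance from `σ x` to `x` is two
(`card_out_le_two_of_three_le`), so `σ` is an involution, the pairs `{x, σ x}` are the parts of a
team tournament, and counting inside out-neighbourhoods gives double regularity and `4 ∣ k + 1 = r`.

Twin classes are semicomplete, of diameter at most two, and share their intersection numbers. If
they are complete, the product is `Δ ∘ K_m`. Otherwise some twins have two-way distance `(1, 2)`. A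
three-cycle of `Δ` would give that distance to non-twins, so `Δ` has none (`not_adj_of_adj_of_adj`);
this excludes the team tournaments and `Cay(ℤ_6, {1, 2})`. Conversely, local semicompleteness passes
from `Δ` to a product with semicomplete factors, and failure of semicompleteness passes up as well.
-/

theorem hasPath_zero_iff : Γ.HasPath 0 x y ↔ x = y := by
  constructor
  · rintro ⟨w, rfl, rfl, -⟩
    rfl
  · rintro rfl
    exact ⟨fun _ => x, rfl, rfl, fun t => t.elim0⟩

theorem hasPath_succ_iff : Γ.HasPath (r + 1) x y ↔ ∃ z, Γ.Adj x z ∧ Γ.HasPath r z y := by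
  constructor
  · rintro ⟨w, rfl, rfl, h⟩
    refine ⟨w (Fin.succ 0), h 0, fun t => w t.succ, rfl, by simp [Fin.succ_last], fun t => ?_⟩
    have := h t.succ
    rwa [← Fin.succ_castSucc] at this
  · rintro ⟨z, hz, w, rfl, rfl, h⟩
    refine ⟨Fin.cons x w, rfl, by simp [← Fin.succ_last], fun t => ?_⟩
    refine Fin.cases ?_ (fun t => ?_) t
    · simpa using hz
    · rw [← Fin.succ_castSucc, Fin.cons_succ, Fin.cons_succ]
      exact h t

theorem hasPath_one_iff : Γ.HasPath 1 x y ↔ Γ.Adj x y := by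
  rw [hasPath_succ_iff]
  simp [hasPath_zero_iff]

theorem dist_le_of_hasPath (h : Γ.HasPath r x y) : Γ.dist x y ≤ r := Nat.sInf_le h

theorem dist_self : Γ.dist x x = 0 := Nat.le_zero.1 (dist_le_of_hasPath (hasPath_zero_iff.2 rfl))

theorem twoWayDist_self : Γ.twoWayDist x x = (0, 0) := by simp [twoWayDist, dist_self]

theorem twoWayDist_comm_eq {W : Type*} {Δ : Digraph W} {x' y' : W}
    (h : Γ.twoWayDist x y = Δ.twoWayDist x' y') : Γ.twoWayDist y x = Δ.twoWayDist y' x' := by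
  simp only [twoWayDist, Prod.mk.injEq] at h ⊢
  exact h.symm

namespace IsStronglyConnected

variable (hc : Γ.IsStronglyConnected)
include hc

theorem hasPath_dist (x y : V) : Γ.HasPath (Γ.dist x y) x y := Nat.sInf_mem (hc x y)

theorem dist_eq_zero : Γ.dist x y = 0 ↔ x = y := by
  refine ⟨fun h => ?_, fun h => h ▸ dist_self⟩
  have := hc.hasPath_dist x y
  rwa [h, hasPath_zero_iff] at this

theorem dist_eq_one (hl : Γ.Loopless) : Γ.dist x y = 1 ↔ Γ.Adj x y := by
  refine ⟨fun h => ?_, fun h => le_antisymm (dist_le_of_hasPath (hasPath_one_iff.2 h)) ?_⟩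
  · have := hc.hasPath_dist x y
    rwa [h, hasPath_one_iff] at this
  · rw [Nat.one_le_iff_ne_zero, Ne, hc.dist_eq_zero]
    rintro rfl
    exact hl x h

theorem dist_le_succ (h : Γ.Adj x z) : Γ.dist x y ≤ Γ.dist z y + 1 :=
  dist_le_of_hasPath (hasPath_succ_iff.2 ⟨z, h, hc.hasPath_dist z y⟩)

theorem exists_adj_dist (h : x ≠ y) : ∃ z, Γ.Adj x z ∧ Γ.dist x y = Γ.dist z y + 1 := by
  have hp := hc.hasPath_dist x y
  obtain ⟨n, hn⟩ : ∃ n, Γ.dist x y = n + 1 :=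
    Nat.exists_eq_succ_of_ne_zero (fun h0 => h (hc.dist_eq_zero.1 h0))
  rw [hn, hasPath_succ_iff] at hp
  obtain ⟨z, hz, hzy⟩ := hp
  refine ⟨z, hz, ?_⟩
  have := dist_le_of_hasPath hzy
  have := hc.dist_le_succ (y := y) hz
  omega

theorem dist_eq_two (hl : Γ.Loopless) :
    Γ.dist x y = 2 ↔ x ≠ y ∧ ¬ Γ.Adj x y ∧ ∃ z, Γ.Adj x z ∧ Γ.Adj z y := by
  constructor
  · intro h
    have hne : x ≠ y := fun h0 => by rw [hc.dist_eq_zero.2 h0] at h; omega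
    refine ⟨hne, fun ha => ?_, ?_⟩
    · rw [(hc.dist_eq_one hl).2 ha] at h
      omega
    · obtain ⟨z, hz, hd⟩ := hc.exists_adj_dist hne
      exact ⟨z, hz, (hc.dist_eq_one hl).1 (by omega)⟩
  · rintro ⟨hne, hna, z, hxz, hzy⟩
    have h1 := hc.dist_le_succ (y := y) hxz
    rw [(hc.dist_eq_one hl).2 hzy] at h1
    have h0 : Γ.dist x y ≠ 0 := fun h => hne (hc.dist_eq_zero.1 h)
    have h2 : Γ.dist x y ≠ 1 := fun h => hna ((hc.dist_eq_one hl).1 h)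
    omega

theorem forall_of_closed {S : V → Prop} (hx : S x) (hS : ∀ y z, S y → Γ.Adj y z → S z) (y : V) :
    S y := by
  obtain ⟨r, hr⟩ := hc x y
  induction r generalizing x with
  | zero => rwa [← hasPath_zero_iff.1 hr]
  | succ r ih =>
    obtain ⟨z, hz, hzy⟩ := hasPath_succ_iff.1 hr
    exact ih (hS x z hx hz) hzy

theorem twoWayDist_eq_zero : Γ.twoWayDist x y = (0, 0) ↔ x = y := by
  refine ⟨fun h => ?_, fun h => h ▸ twoWayDist_self⟩
  simp only [twoWayDist, Prod.mk.injEq] at h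
  exact hc.dist_eq_zero.1 h.1

theorem adj_iff_of_twoWayDist_eq (hl : Γ.Loopless) {x' y' : V}
    (h : Γ.twoWayDist x y = Γ.twoWayDist x' y') : Γ.Adj x y ↔ Γ.Adj x' y' := by
  simp only [twoWayDist, Prod.mk.injEq] at h
  rw [← hc.dist_eq_one hl, ← hc.dist_eq_one hl, h.1]

end IsStronglyConnected

theorem isLocallySemicomplete_iff : Γ.IsLocallySemicomplete ↔ ∀ x y z, y ≠ z →
    (Γ.Adj x y → Γ.Adj x z → Γ.Adj y z ∨ Γ.Adj z y) ∧
    (Γ.Adj y x → Γ.Adj z x → Γ.Adj y z ∨ Γ.Adj z y) := by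
  constructor
  · intro h x y z hyz
    exact ⟨fun hy hz => (h x).1 ⟨y, hy⟩ ⟨z, hz⟩ (fun h => hyz (congrArg Subtype.val h)),
      fun hy hz => (h x).2 ⟨y, hy⟩ ⟨z, hz⟩ (fun h => hyz (congrArg Subtype.val h))⟩
  · intro h x
    exact ⟨fun y z hyz => (h x y z (fun h => hyz (Subtype.ext h))).1 y.2 z.2,
      fun y z hyz => (h x y z (fun h => hyz (Subtype.ext h))).2 y.2 z.2⟩

end Basic

/-! ### Counting in weakly distance-regular digraphs. -/

section Counting

variable {V : Type*} [Fintype V] {Γ : Digraph V}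

theorem ncard_setOf_eq_card (p : V → Prop) : {z | p z}.ncard = #{z | p z} := by
  rw [Set.ncard_eq_toFinset_card']
  congr 1
  ext z
  simp

namespace IsWeaklyDistanceRegular

variable (hw : Γ.IsWeaklyDistanceRegular)
include hw

/-- Counts of vertices by conditions on two-way distances to `x` and `y` depend only on the
two-way distance from `x` to `y`. -/
theorem card_eq {x y x' y' : V} (hxy : Γ.twoWayDist x y = Γ.twoWayDist x' y')
    (P Q : ℕ × ℕ → Prop) :
    #{z | P (Γ.twoWayDist x z) ∧ Q (Γ.twoWayDist z y)} =
      #{z | P (Γ.twoWayDist x' z) ∧ Q (Γ.twoWayDist z y')} := by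
  let T : Finset (ℕ × ℕ) := Finset.univ.image fun p : V × V => Γ.twoWayDist p.1 p.2
  have hT : ∀ a b, Γ.twoWayDist a b ∈ T := fun a b =>
    Finset.mem_image.2 ⟨(a, b), Finset.mem_univ _, rfl⟩
  rw [Finset.card_eq_sum_card_fiberwise (t := T ×ˢ T)
      (f := fun z => (Γ.twoWayDist x z, Γ.twoWayDist z y))
      (fun z _ => by simpa using ⟨hT _ _, hT _ _⟩),
    Finset.card_eq_sum_card_fiberwise (t := T ×ˢ T)
      (f := fun z => (Γ.twoWayDist x' z, Γ.twoWayDist z y'))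
      (fun z _ => by simpa using ⟨hT _ _, hT _ _⟩)]
  refine Finset.sum_congr rfl fun ij hij => ?_
  obtain ⟨i, j⟩ := ij
  simp only [Finset.mem_product] at hij
  have hmem : ∀ t ∈ T, t ∈ Γ.twoWayDistSet := fun t ht => by
    obtain ⟨p, -, rfl⟩ := Finset.mem_image.1 ht
    exact ⟨p.1, p.2, rfl⟩
  by_cases hPQ : P i ∧ Q j
  · obtain ⟨p, hp⟩ := hw.2 _ ⟨x, y, rfl⟩ i (hmem _ hij.1) j (hmem _ hij.2)
    have h1 := hp x y rfl
    have h2 := hp x' y' hxy.symm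
    rw [ncard_setOf_eq_card] at h1 h2
    convert h1.trans h2.symm using 2 <;>
    · ext z
      simp only [Finset.mem_filter, Finset.mem_univ, true_and, Prod.mk.injEq]
      constructor
      · exact fun h => h.2
      · rintro ⟨rfl, rfl⟩
        exact ⟨hPQ, rfl, rfl⟩
  · rw [Finset.card_eq_zero.2, Finset.card_eq_zero.2] <;>
    · ext z
      simp only [Finset.mem_filter, Finset.mem_univ, true_and, Prod.mk.injEq, Finset.notMem_empty,
        iff_false]
      rintro ⟨h, rfl, rfl⟩
      exact hPQ h

theorem card_eq_of_vertex (P : ℕ × ℕ → Prop) (x x' : V) :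
    #{z | P (Γ.twoWayDist x z)} = #{z | P (Γ.twoWayDist x' z)} := by
  simpa using hw.card_eq (x := x) (y := x) (x' := x') (y' := x')
    (by rw [twoWayDist_self, twoWayDist_self]) P (fun _ => True)

theorem exists_twoWayDist_eq (x y x' : V) : ∃ z, Γ.twoWayDist x' z = Γ.twoWayDist x y := by
  have h := hw.card_eq_of_vertex (fun t => t = Γ.twoWayDist x y) x x'
  have : 0 < #{z | Γ.twoWayDist x z = Γ.twoWayDist x y} :=
    Finset.card_pos.2 ⟨y, by simp⟩
  replace this : 0 < #{z | Γ.twoWayDist x' z = Γ.twoWayDist x y} :=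
    this.trans_eq (by convert h)
  obtain ⟨z, hz⟩ := Finset.card_pos.1 this
  exact ⟨z, by simpa using hz⟩

variable (hl : Γ.Loopless)
include hl

theorem card_between_eq {x y x' y' : V} (hxy : Γ.twoWayDist x y = Γ.twoWayDist x' y') :
    #{z | Γ.Adj x z ∧ Γ.Adj z y} = #{z | Γ.Adj x' z ∧ Γ.Adj z y'} := by
  have := hw.card_eq hxy (fun t => t.1 = 1) (fun t => t.1 = 1)
  simpa only [twoWayDist, hw.1.dist_eq_one hl] using this

theorem card_out_eq (x x' : V) : #{z | Γ.Adj x z} = #{z | Γ.Adj x' z} := by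
  have := hw.card_eq_of_vertex (fun t => t.1 = 1) x x'
  simpa only [twoWayDist, hw.1.dist_eq_one hl] using this

/-- Both valencies are constant, and counting all arcs by tail and by head identifies them. -/
theorem card_in_eq_out (x x' : V) : #{z | Γ.Adj z x} = #{z | Γ.Adj x' z} := by
  have hin : ∀ y, #{z | Γ.Adj z y} = #{z | Γ.Adj z x} := fun y => by
    have := hw.card_eq_of_vertex (fun t => t.2 = 1) y x
    simpa only [twoWayDist, hw.1.dist_eq_one hl] using this
  have h := Finset.sum_card_bipartiteAbove_eq_sum_card_bipartiteBelow (s := Finset.univ)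
    (t := Finset.univ) Γ.Adj
  simp only [Finset.bipartiteAbove, Finset.bipartiteBelow] at h
  rw [Finset.sum_congr rfl fun y _ => hw.card_out_eq hl y x',
    Finset.sum_congr rfl fun y _ => hin y] at h
  simp only [Finset.sum_const, smul_eq_mul] at h
  exact (Nat.eq_of_mul_eq_mul_left (Finset.card_pos.2 ⟨x, Finset.mem_univ _⟩) h).symm

end IsWeaklyDistanceRegular

end Counting

end Digraph

/-! ### Separated local tournaments: antipodes. -/

namespace Digraph

/-- Oriented digraphs whose out- and in-neighbourhoods induce tournaments, and in which the head of
each arc has an out-neighbour which is not joined to the tail. -/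
structure IsSeparatedLocalTournament {V : Type*} (Γ : Digraph V) : Prop where
  asymm : ∀ x y, Γ.Adj x y → ¬ Γ.Adj y x
  out_adj : ∀ x y z, Γ.Adj x y → Γ.Adj x z → y ≠ z → Γ.Adj y z ∨ Γ.Adj z y
  in_adj : ∀ x y z, Γ.Adj y x → Γ.Adj z x → y ≠ z → Γ.Adj y z ∨ Γ.Adj z y
  sep : ∀ x y, Γ.Adj x y → ∃ z, Γ.Adj y z ∧ ¬ Γ.Adj x z ∧ ¬ Γ.Adj z x ∧ z ≠ x

/-- Each `σ x` is distinct from `x`, not joined to `x`, and its in-neighbours are the out-neighbours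
of `x`. -/
structure IsAntipodal {V : Type*} (Γ : Digraph V) (σ : V → V) : Prop where
  ne : ∀ x, σ x ≠ x
  not_adj : ∀ x, ¬ Γ.Adj (σ x) x
  adj_iff : ∀ x y, Γ.Adj y (σ x) ↔ Γ.Adj x y

namespace IsSeparatedLocalTournament

variable {V : Type*} [Fintype V] {Γ : Digraph V} {σ : V → V} {k : ℕ}
variable (h : Γ.IsSeparatedLocalTournament)
include h

omit [Fintype V] in
theorem loopless : Γ.Loopless := fun x hx => h.asymm x x hx hx

omit [Fintype V] in
theorem ne_of_adj {x y : V} (hxy : Γ.Adj x y) : x ≠ y := by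
  rintro rfl
  exact h.loopless _ hxy

theorem card_out_eq_add {x y : V} (hxy : Γ.Adj x y) :
    #{z | Γ.Adj x z} = #{z | Γ.Adj x z ∧ Γ.Adj z y} + #{z | Γ.Adj x z ∧ Γ.Adj y z} + 1 := by
  have hs : ({z | Γ.Adj x z} : Finset V) =
      insert y (({z | Γ.Adj x z ∧ Γ.Adj z y} : Finset V) ∪
        ({z | Γ.Adj x z ∧ Γ.Adj y z} : Finset V)) := by
    ext z
    simp only [Finset.mem_filter, Finset.mem_univ, true_and, Finset.mem_insert, Finset.mem_union]
    constructor
    · intro hz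
      by_cases hzy : z = y
      · exact Or.inl hzy
      · rcases h.out_adj x z y hz hxy hzy with h1 | h1
        · exact Or.inr (Or.inl ⟨hz, h1⟩)
        · exact Or.inr (Or.inr ⟨hz, h1⟩)
    · rintro (rfl | h1 | h1)
      · exact hxy
      · exact h1.1
      · exact h1.1
  rw [hs, Finset.card_insert_of_notMem, Finset.card_union_of_disjoint]
  · rw [Finset.disjoint_left]
    intro z h1 h2
    simp only [Finset.mem_filter, Finset.mem_univ, true_and] at h1 h2
    exact h.asymm _ _ h1.2 h2.2
  · simp [h.loopless y]

/-- Among the vertices not joined to `x` that are reached from `x` in two steps, one with the most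
vertices between works: all out-neighbours of `x` turn out to precede it, and equality of valencies
does the rest. -/
theorem exists_antipode (hw : Γ.IsWeaklyDistanceRegular) {x y : V} (hxy : Γ.Adj x y) :
    ∃ z, z ≠ x ∧ ¬ Γ.Adj z x ∧ ∀ y, Γ.Adj y z ↔ Γ.Adj x y := by
  obtain ⟨z, hz, hmax⟩ := Finset.exists_max_image
    ({z | z ≠ x ∧ ¬ Γ.Adj x z ∧ ¬ Γ.Adj z x ∧ ∃ y, Γ.Adj x y ∧ Γ.Adj y z} : Finset V)
    (fun z => #{y | Γ.Adj x y ∧ Γ.Adj y z}) (by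
      obtain ⟨z, h1, h2, h3, h4⟩ := h.sep x y hxy
      exact ⟨z, by simpa using ⟨h4, h2, h3, y, hxy, h1⟩⟩)
  simp only [Finset.mem_filter, Finset.mem_univ, true_and] at hz hmax
  obtain ⟨hzx, hxz, hzx', y0, hy0, hy0z⟩ := hz
  -- `v` and `z` are joined as out-neighbours of `u`; an arc from `z` to `v` would make `x` and `z`
  -- in-neighbours of `v`, hence joined.
  have hclosed : ∀ z, z ≠ x → ¬ Γ.Adj x z → ¬ Γ.Adj z x → ∀ u v, Γ.Adj x v →
      Γ.Adj u z → Γ.Adj u v → Γ.Adj v z := by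
    intro z h1 h2 h3 u v hv huz huv
    have hvz : v ≠ z := fun h0 => h2 (h0 ▸ hv)
    rcases h.out_adj u v z huv huz hvz with h0 | h0
    · exact h0
    · exact absurd (h.in_adj v x z hv h0 h1.symm) (by tauto)
  -- If `u` does not precede `z`, separation of the arc from `x` to `u` yields `w` after `u`. By
  -- `hclosed`, everything between `x` and `z` comes after `u` and so precedes `w`; with `u` itself
  -- this beats the maximum.
  have hsub : ∀ u, Γ.Adj x u → Γ.Adj u z := by
    by_contra! hcon
    obtain ⟨u, hu, huz⟩ := hcon
    obtain ⟨w, h1, h2, h3, h4⟩ := h.sep x u hu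
    have hle := hmax w ⟨h4, h2, h3, u, hu, h1⟩
    refine absurd hle (not_le.2 (Finset.card_lt_card ?_))
    rw [Finset.ssubset_iff_of_subset]
    · exact ⟨u, by simpa using ⟨hu, h1⟩, by simpa using fun _ => huz⟩
    · intro v hv
      simp only [Finset.mem_filter, Finset.mem_univ, true_and] at hv ⊢
      refine ⟨hv.1, hclosed w h4 h2 h3 u v hv.1 h1 ?_⟩
      rcases h.out_adj x u v hu hv.1 (fun h0 => huz (h0 ▸ hv.2)) with h0 | h0
      · exact h0
      · exact absurd (hclosed z hzx hxz hzx' v u hu hv.2 h0) huz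
  refine ⟨z, hzx, hzx', fun y => ?_⟩
  have heq : ({u | Γ.Adj x u} : Finset V) = ({u | Γ.Adj u z} : Finset V) := by
    refine Finset.eq_of_subset_of_card_le (fun u hu => ?_)
      (hw.card_in_eq_out h.loopless z x).le
    simpa using hsub u (by simpa using hu)
  simpa using (Finset.ext_iff.1 heq y).symm

theorem exists_isAntipodal (hw : Γ.IsWeaklyDistanceRegular) {x y : V} (hxy : Γ.Adj x y) :
    ∃ σ, Γ.IsAntipodal σ := by
  have hout : ∀ x', ∃ y', Γ.Adj x' y' := fun x' => by
    obtain ⟨z, hz⟩ := hw.exists_twoWayDist_eq x y x'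
    exact ⟨z, (hw.1.adj_iff_of_twoWayDist_eq h.loopless hz).2 hxy⟩
  choose σ h1 h2 h3 using fun x' => h.exists_antipode hw (hout x').choose_spec
  exact ⟨σ, h1, h2, h3⟩

variable (hσ : Γ.IsAntipodal σ)
include hσ

omit [Fintype V] in
theorem not_adj_antipode (x : V) : ¬ Γ.Adj x (σ x) := by
  rw [hσ.adj_iff]
  exact h.loopless x

variable (hw : Γ.IsWeaklyDistanceRegular) (hk : ∀ x, #{z | Γ.Adj x z} = k) (hk0 : 0 < k)
include hw hk hk0

/-- Two candidates share an in-neighbour, so they are joined; as both have in-neighbourhood `N⁺(x)`,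
an arc from one to the other produces a loop. -/
theorem eq_antipode {x z : V} (hz : ∀ y, Γ.Adj x y → Γ.Adj y z) : z = σ x := by
  by_contra hne
  obtain ⟨y, hy⟩ : ∃ y, Γ.Adj x y := by
    have := hk x
    obtain ⟨y, hy⟩ := Finset.card_pos.1 (hk0.trans_eq this.symm)
    exact ⟨y, by simpa using hy⟩
  have heq : ({u | Γ.Adj x u} : Finset V) = ({u | Γ.Adj u z} : Finset V) := by
    refine Finset.eq_of_subset_of_card_le (fun u hu => ?_)
      (hw.card_in_eq_out h.loopless z x).le
    simpa using hz u (by simpa using hu)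
  have heq' : ∀ u, Γ.Adj x u ↔ Γ.Adj u z := fun u => by simpa using Finset.ext_iff.1 heq u
  rcases h.out_adj y z (σ x) (hz y hy) ((hσ.adj_iff x y).2 hy) hne with h0 | h0
  · exact h.loopless z ((heq' z).1 ((hσ.adj_iff x z).1 h0))
  · exact h.not_adj_antipode hσ x ((heq' _).2 h0)

/-- All `k` out-neighbours of `x'` lie between `x'` and `σ x'`, so the same count for `x` and `z`
exhausts `N⁺(x)`. -/
theorem eq_antipode_of_twoWayDist_eq {x z x' : V}
    (hz : Γ.twoWayDist x z = Γ.twoWayDist x' (σ x')) : z = σ x := by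
  refine h.eq_antipode hσ hw hk hk0 fun y hy => ?_
  have hc := hw.card_between_eq h.loopless hz
  have h1 : #{w | Γ.Adj x' w ∧ Γ.Adj w (σ x')} = k := by
    simp only [hσ.adj_iff, and_self, hk]
  have heq : ({w | Γ.Adj x w ∧ Γ.Adj w z} : Finset V) = ({w | Γ.Adj x w} : Finset V) := by
    refine Finset.eq_of_subset_of_card_le (fun w hw => ?_) (by rw [hk, hc, h1])
    simp only [Finset.mem_filter, Finset.mem_univ, true_and] at hw ⊢
    exact hw.1
  have := (Finset.ext_iff.1 heq y).2 (by simpa using hy)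
  simp only [Finset.mem_filter, Finset.mem_univ, true_and] at this
  exact this.2

theorem twoWayDist_antipode_eq (x x' : V) :
    Γ.twoWayDist x (σ x) = Γ.twoWayDist x' (σ x') := by
  obtain ⟨z, hz⟩ := hw.exists_twoWayDist_eq x' (σ x') x
  rwa [h.eq_antipode_of_twoWayDist_eq hσ hw hk hk0 hz] at hz

omit hk0 in
theorem two_mul_add_two_le_card (x : V) : 2 * k + 2 ≤ Fintype.card V := by
  have h1 : #({x, σ x} : Finset V) = 2 := Finset.card_pair (hσ.ne x).symm
  have h2 := hw.card_in_eq_out h.loopless x x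
  rw [hk] at h2
  have h3 : Disjoint ({z | Γ.Adj x z} : Finset V) ({z | Γ.Adj z x} : Finset V) := by
    rw [Finset.disjoint_left]
    intro z h1 h2
    simp only [Finset.mem_filter, Finset.mem_univ, true_and] at h1 h2
    exact h.asymm _ _ h1 h2
  have h4 : Disjoint ({x, σ x} : Finset V)
      (({z | Γ.Adj x z} : Finset V) ∪ ({z | Γ.Adj z x} : Finset V)) := by
    rw [Finset.disjoint_left]
    intro z h1 h2
    simp only [Finset.mem_filter, Finset.mem_univ, true_and, Finset.mem_insert,
      Finset.mem_singleton, Finset.mem_union] at h1 h2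
    rcases h1 with rfl | rfl
    · exact h.loopless z (by tauto)
    · exact h2.elim (h.not_adj_antipode hσ x) (hσ.not_adj x)
  have h5 := Finset.card_le_univ (({x, σ x} : Finset V) ∪
      (({z | Γ.Adj x z} : Finset V) ∪ ({z | Γ.Adj z x} : Finset V)))
  rw [Finset.card_union_of_disjoint h4, Finset.card_union_of_disjoint h3, h1, h2, hk] at h5
  omega

omit h hσ hw hk0 in
theorem exists_map_of_card_eq_one (hk1 : k = 1) : ∃ τ : V → V, ∀ x y, Γ.Adj x y ↔ y = τ x := by
  have : ∀ x, ∃ a, ∀ y, Γ.Adj x y ↔ y = a := fun x => by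
    obtain ⟨a, ha⟩ := Finset.card_eq_one.1 ((hk x).trans hk1)
    exact ⟨a, fun y => by simpa using Finset.ext_iff.1 ha y⟩
  choose τ hτ using this
  exact ⟨τ, hτ⟩

-- Let `τ x` and `ρ x` be the tail and head of the arc inside `N⁺(x)`. Both precede `σ x`, so `N⁺(τ
-- x)` contains `ρ x` and `σ x`; the arc from `ρ x` to `σ x` then forces `ρ x = τ (τ x)`.
omit hw hk0 in
theorem exists_map_of_card_eq_two (hk2 : k = 2) :
    ∃ τ : V → V, ∀ x y, Γ.Adj x y ↔ y = τ x ∨ y = τ (τ x) := by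
  have : ∀ x, ∃ a b, Γ.Adj a b ∧ ∀ y, Γ.Adj x y ↔ y = a ∨ y = b := fun x => by
    obtain ⟨a, b, hab, hs⟩ := Finset.card_eq_two.1 ((hk x).trans hk2)
    have hs' : ∀ y, Γ.Adj x y ↔ y = a ∨ y = b := fun y => by simpa using Finset.ext_iff.1 hs y
    rcases h.out_adj x a b ((hs' a).2 (Or.inl rfl)) ((hs' b).2 (Or.inr rfl)) hab with h0 | h0
    · exact ⟨a, b, h0, hs'⟩
    · exact ⟨b, a, h0, fun y => by rw [hs', or_comm]⟩
  choose τ ρ h1 h2 using this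
  refine ⟨τ, fun x y => ?_⟩
  suffices hρ : ρ x = τ (τ x) by rw [h2, hρ]
  have hτσ : Γ.Adj (τ x) (σ x) := (hσ.adj_iff _ _).2 ((h2 _ _).2 (Or.inl rfl))
  have hρσ : Γ.Adj (ρ x) (σ x) := (hσ.adj_iff _ _).2 ((h2 _ _).2 (Or.inr rfl))
  rcases (h2 _ _).1 (h1 x) with h3 | h3
  · exact h3
  · rcases (h2 _ _).1 hτσ with h4 | h4
    · have := h1 (τ x)
      rw [← h3, ← h4] at this
      exact absurd hρσ (h.asymm _ _ this)
    · rw [h4, ← h3] at hρσ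
      exact absurd hρσ (h.loopless _)

-- Without three-cycles the tournament on `N⁺(x)` is transitive, so the number of vertices between
-- `x` and `y` separates the out-neighbours `y`. That number is determined by the return distance,
-- which takes only two values.
omit hw hk hk0 hσ in
theorem card_out_le_two_of_dist (t : ℕ) (x : V)
    (h3 : ∀ x y z, Γ.Adj x y → Γ.Adj y z → ¬ Γ.Adj z x)
    (hw : Γ.IsWeaklyDistanceRegular)
    (ht : ∀ y, Γ.Adj x y → Γ.dist y x = t ∨ Γ.dist y x = t + 1) :
    #{z | Γ.Adj x z} ≤ 2 := by
  have hinj : Set.InjOn (fun y => Γ.dist y x) ({z | Γ.Adj x z} : Finset V) := by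
    have key : ∀ y z, Γ.Adj x y → Γ.Adj x z → Γ.Adj y z → Γ.dist y x ≠ Γ.dist z x := by
      intro y z hy hz hyz hd
      have htw : Γ.twoWayDist x y = Γ.twoWayDist x z := by
        simp only [twoWayDist, hd, (hw.1.dist_eq_one h.loopless).2 hy,
          (hw.1.dist_eq_one h.loopless).2 hz]
      refine (Finset.card_lt_card ?_).ne (hw.card_between_eq h.loopless htw)
      rw [Finset.ssubset_iff_of_subset]
      · exact ⟨y, by simpa using ⟨hy, hyz⟩, by simpa using fun _ => h.loopless y⟩
      · intro u hu
        simp only [Finset.mem_filter, Finset.mem_univ, true_and] at hu ⊢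
        refine ⟨hu.1, ?_⟩
        rcases h.out_adj x u z hu.1 hz (fun h0 => h.asymm _ _ hyz (h0 ▸ hu.2)) with h0 | h0
        · exact h0
        · exact absurd h0 (h3 u y z hu.2 hyz |> fun h => absurd h0 h)
    intro y hy z hz hd
    simp only [Finset.coe_filter, Finset.mem_univ, true_and, Set.mem_ofPred_eq] at hy hz
    by_contra hne
    rcases h.out_adj x y z hy hz hne with h0 | h0
    · exact key y z hy hz h0 hd
    · exact key z y hz hy h0 hd.symm
  rw [← Finset.card_image_of_injOn hinj]
  refine (Finset.card_le_card (t := {t, t + 1}) fun n hn => ?_).trans Finset.card_le_two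
  obtain ⟨y, hy, rfl⟩ := Finset.mem_image.1 hn
  simpa using ht y (by simpa using hy)

omit hk hk0 in
theorem card_out_le_two_of_three_le (x : V) (ht : ∀ y, Γ.dist (σ y) y = Γ.dist (σ x) x)
    (h3 : 3 ≤ Γ.dist (σ x) x) : #{z | Γ.Adj x z} ≤ 2 := by
  set t := Γ.dist (σ x) x with ht0
  -- No arc has return distance below `t`. The first vertex `z` of a shortest way back from `y` is
  -- `σ x` or joined to it: an arc from `z` to `σ x` makes `z` an out-neighbour of `x` with smaller
  -- return distance, and an arc from `σ x` to `z` bounds `t` directly.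
  have hge : ∀ x n y, Γ.Adj x y → Γ.dist y x = n → t ≤ n := by
    intro x n
    induction n with
    | zero =>
      intro y hy h0
      exact absurd (hw.1.dist_eq_zero.1 h0).symm (h.ne_of_adj hy)
    | succ n ih =>
      intro y hy hn
      obtain ⟨z, hyz, hd⟩ := hw.1.exists_adj_dist (h.ne_of_adj hy).symm
      by_cases hz : z = σ x
      · rw [hz, ht] at hd
        omega
      · rcases h.out_adj y z (σ x) hyz ((hσ.adj_iff _ _).2 hy) hz with h0 | h0
        · have := ih z ((hσ.adj_iff _ _).1 h0) (by omega)
          omega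
        · have := hw.1.dist_le_succ (y := x) h0
          rw [ht] at this
          omega
  refine h.card_out_le_two_of_dist t x (fun a b c hab hbc hca => ?_) hw fun y hy => ?_
  · have h1 := hge a _ b hab rfl
    have h2 := hw.1.dist_le_succ (y := a) hbc
    rw [(hw.1.dist_eq_one h.loopless).2 hca] at h2
    omega
  · have h1 := hge x _ y hy rfl
    have h2 := hw.1.dist_le_succ (y := x) ((hσ.adj_iff x y).2 hy)
    omega

end IsSeparatedLocalTournament

end Digraph

/-! ### Involutive antipodes: counting inside out-neighbourhoods. -/

namespace Digraph

namespace IsSeparatedLocalTournament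

variable {V : Type*} {Γ : Digraph V} {σ : V → V} {k : ℕ}
variable (h : Γ.IsSeparatedLocalTournament) (hσ : Γ.IsAntipodal σ) (hinv : ∀ x, σ (σ x) = x)

section Involution

include hσ hinv

theorem antipode_adj_iff (x y : V) : Γ.Adj (σ x) y ↔ Γ.Adj y x := by
  rw [← hσ.adj_iff, hinv]

include h

/-- The set of vertices described is closed under out-arcs, hence everything by strong connectivity.
-/
theorem eq_or_eq_antipode_or_adj (hc : Γ.IsStronglyConnected) (x y : V) :
    y = x ∨ y = σ x ∨ Γ.Adj x y ∨ Γ.Adj y x := by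
  refine hc.forall_of_closed (x := x)
    (S := fun y => y = x ∨ y = σ x ∨ Γ.Adj x y ∨ Γ.Adj y x) (Or.inl rfl) ?_ y
  rintro y z (rfl | rfl | hxy | hyx) hyz
  · exact Or.inr (Or.inr (Or.inl hyz))
  · exact Or.inr (Or.inr (Or.inr ((antipode_adj_iff hσ hinv x z).1 hyz)))
  · by_cases hz : z = σ x
    · exact Or.inr (Or.inl hz)
    · rcases h.out_adj y z (σ x) hyz ((hσ.adj_iff _ _).2 hxy) hz with h0 | h0
      · exact Or.inr (Or.inr (Or.inl ((hσ.adj_iff _ _).1 h0)))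
      · exact Or.inr (Or.inr (Or.inr ((antipode_adj_iff hσ hinv x z).1 h0)))
  · by_cases hz : z = x
    · exact Or.inl hz
    · exact Or.inr (Or.inr (h.out_adj y x z hyx hyz (Ne.symm hz)))

-- The involution `σ` exchanges the vertices between `x` and `y` with those between `y` and `x`.
omit h in
theorem card_between_eq_card_back [Fintype V] (x y : V) :
    #{z | Γ.Adj x z ∧ Γ.Adj z y} = #{z | Γ.Adj y z ∧ Γ.Adj z x} := by
  refine Finset.card_nbij' σ σ (fun z hz => ?_) (fun z hz => ?_) (fun z _ => hinv z)
    (fun z _ => hinv z) <;>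
  · simp only [Finset.coe_filter, Finset.mem_univ, true_and, Set.mem_ofPred_eq] at hz ⊢
    exact ⟨(hσ.adj_iff _ _).2 hz.2, (antipode_adj_iff hσ hinv _ _).2 hz.1⟩

variable [Fintype V] (hw : Γ.IsWeaklyDistanceRegular)
include hw

theorem dist_back_eq_two_of_between {x y z : V} (hxy : Γ.Adj x y) (hxz : Γ.Adj x z)
    (hzy : Γ.Adj z y) : Γ.dist y x = 2 := by
  rw [hw.1.dist_eq_two h.loopless]
  have h1 : 0 < #{z | Γ.Adj x z ∧ Γ.Adj z y} := Finset.card_pos.2 ⟨z, by simpa using ⟨hxz, hzy⟩⟩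
  rw [card_between_eq_card_back hσ hinv] at h1
  obtain ⟨u, hu⟩ := Finset.card_pos.1 h1
  exact ⟨(h.ne_of_adj hxy).symm, h.asymm _ _ hxy, u, by simpa using hu⟩

theorem twoWayDist_eq_of_between {x y z : V} (hxy : Γ.Adj x y) (hxz : Γ.Adj x z)
    (hzy : Γ.Adj z y) : Γ.twoWayDist x y = (1, 2) := by
  rw [twoWayDist, h.dist_back_eq_two_of_between hσ hinv hw hxy hxz hzy,
    (hw.1.dist_eq_one h.loopless).2 hxy]

variable (hk : ∀ x, #{z | Γ.Adj x z} = k) (hk3 : 3 ≤ k)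
include hk hk3

/-- Otherwise every out-neighbourhood would have a source, and the source of the
out-neighbourhood of the source would be of in-degree one there. -/
theorem exists_between {x y : V} (hxy : Γ.Adj x y) : ∃ z, Γ.Adj x z ∧ Γ.Adj z y := by
  by_contra! hno
  have hsrc : ∀ x', ∃ y', Γ.Adj x' y' ∧ ∀ z, Γ.Adj x' z → ¬ Γ.Adj z y' := fun x' => by
    obtain ⟨y', hy'⟩ := hw.exists_twoWayDist_eq x y x'
    refine ⟨y', (hw.1.adj_iff_of_twoWayDist_eq h.loopless hy').2 hxy, fun z h1 h2 => ?_⟩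
    have h0 : 0 < #{z | Γ.Adj x' z ∧ Γ.Adj z y'} :=
      Finset.card_pos.2 ⟨z, by simpa using ⟨h1, h2⟩⟩
    rw [hw.card_between_eq h.loopless hy'] at h0
    obtain ⟨u, hu⟩ := Finset.card_pos.1 h0
    simp only [Finset.mem_filter, Finset.mem_univ, true_and] at hu
    exact hno u hu.1 hu.2
  choose τ hτ hτs using hsrc
  have hdom : ∀ x y, Γ.Adj x y → y ≠ τ x → Γ.Adj (τ x) y := fun x y hy hne =>
    (h.out_adj x y (τ x) hy (hτ x) hne).resolve_left (hτs x y hy)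
  have hpick : ∀ a b, ∃ y, Γ.Adj x y ∧ y ≠ a ∧ y ≠ b := fun a b => by
    have h1 : 0 < #(({z | Γ.Adj x z} : Finset V) \ {a, b}) := by
      have := Finset.le_card_sdiff ({a, b} : Finset V) ({z | Γ.Adj x z} : Finset V)
      have h2 : #({a, b} : Finset V) ≤ 2 := Finset.card_le_two
      rw [hk] at this
      omega
    obtain ⟨y, hy⟩ := Finset.card_pos.1 h1
    exact ⟨y, by simpa using hy⟩
  have hττ : τ (τ x) ≠ σ x := fun h0 => by
    obtain ⟨y, hy, hne, -⟩ := hpick (τ x) (τ x)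
    refine hτs (τ x) y (hdom x y hy hne) ?_
    rw [h0]
    exact (hσ.adj_iff _ _).2 hy
  -- `σ x` and the out-neighbours of `x` other than `τ x` are already `k` out-neighbours of `τ x`,
  -- so there are no others.
  have hxττ : Γ.Adj x (τ (τ x)) := by
    have hsub : insert (σ x) (({z | Γ.Adj x z} : Finset V).erase (τ x)) =
        ({z | Γ.Adj (τ x) z} : Finset V) := by
      refine Finset.eq_of_subset_of_card_le (fun z hz => ?_) ?_
      · simp only [Finset.mem_insert, Finset.mem_erase, Finset.mem_filter, Finset.mem_univ,
          true_and] at hz ⊢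
        rcases hz with rfl | ⟨h1, h2⟩
        · exact (hσ.adj_iff _ _).2 (hτ x)
        · exact hdom x z h2 h1
      · rw [Finset.card_insert_of_notMem (by simp [h.not_adj_antipode hσ x]),
          Finset.card_erase_of_mem (by simpa using hτ x), hk, hk]
        omega
    have := (Finset.ext_iff.1 hsub (τ (τ x))).2 (by simpa using hτ (τ x))
    simp only [Finset.mem_insert, Finset.mem_erase, Finset.mem_filter, Finset.mem_univ,
      true_and] at this
    exact (this.resolve_left hττ).2
  obtain ⟨y, hy, hy1, hy2⟩ := hpick (τ x) (τ (τ x))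
  have h1 : Γ.Adj (τ x) y := hdom x y hy hy1
  have h2 : Γ.Adj (τ (τ x)) y := hdom (τ x) y h1 hy2
  -- Both pairs have two-way distance `(1, 2)`, yet only `τ x` can lie between the first, while `τ
  -- x` and `τ (τ x)` lie between the second.
  have htw : Γ.twoWayDist x (τ (τ x)) = Γ.twoWayDist x y := by
    rw [h.twoWayDist_eq_of_between hσ hinv hw hxττ (hτ x) (hτ (τ x)),
      h.twoWayDist_eq_of_between hσ hinv hw hy (hτ x) h1]
  have hc := hw.card_between_eq h.loopless htw
  have hle : #{z | Γ.Adj x z ∧ Γ.Adj z (τ (τ x))} ≤ 1 := by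
    refine (Finset.card_le_card (t := {τ x}) fun u hu => ?_).trans (Finset.card_singleton _).le
    simp only [Finset.mem_filter, Finset.mem_univ, true_and, Finset.mem_singleton] at hu ⊢
    by_contra hne
    exact hτs (τ x) u (hdom x u hu.1 hne) hu.2
  have hge : 1 < #{z | Γ.Adj x z ∧ Γ.Adj z y} :=
    Finset.one_lt_card.2 ⟨τ x, by simpa using ⟨hτ x, h1⟩, τ (τ x), by simpa using ⟨hxττ, h2⟩,
      h.ne_of_adj (hτ (τ x))⟩
  omega

theorem twoWayDist_eq_one_two {x y : V} (hxy : Γ.Adj x y) : Γ.twoWayDist x y = (1, 2) := by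
  obtain ⟨z, h1, h2⟩ := h.exists_between hσ hinv hw hk hk3 hxy
  exact h.twoWayDist_eq_of_between hσ hinv hw hxy h1 h2

/-- In the tournament on `N⁺(x)` all in-degrees are `α` and all out-degrees are `k - 1 - α`; their
sums agree, so the tournament is regular. -/
theorem two_mul_card_between_add_one {x y : V} (hxy : Γ.Adj x y) :
    2 * #{z | Γ.Adj x z ∧ Γ.Adj z y} + 1 = k := by
  set α := #{z | Γ.Adj x z ∧ Γ.Adj z y} with hα
  have hconst : ∀ z, Γ.Adj x z → #{u | Γ.Adj x u ∧ Γ.Adj u z} = α := fun z hz =>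
    hw.card_between_eq h.loopless ((h.twoWayDist_eq_one_two hσ hinv hw hk hk3 hz).trans
      (h.twoWayDist_eq_one_two hσ hinv hw hk hk3 hxy).symm)
  have hconst' : ∀ z, Γ.Adj x z → #{u | Γ.Adj x u ∧ Γ.Adj z u} = k - 1 - α := fun z hz => by
    have h1 := h.card_out_eq_add hz
    rw [hk, hconst z hz] at h1
    omega
  have hd := Finset.sum_card_bipartiteAbove_eq_sum_card_bipartiteBelow
    (s := ({z | Γ.Adj x z} : Finset V)) (t := ({z | Γ.Adj x z} : Finset V)) Γ.Adj
  simp only [Finset.bipartiteAbove, Finset.bipartiteBelow, Finset.filter_filter] at hd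
  rw [Finset.sum_congr rfl fun z hz => hconst z (by simpa using hz),
    Finset.sum_congr rfl fun z hz => hconst' z (by simpa using hz)] at hd
  simp only [Finset.sum_const, smul_eq_mul, hk] at hd
  have h1 := Nat.eq_of_mul_eq_mul_left (by omega) hd
  have h2 := h.card_out_eq_add hxy
  rw [hk, ← hα] at h2
  omega

/-- Take `z` after both `x` and `y`. Let `a`, `b`, `c` count the `w` in `N⁺(x)` that come after both
`y` and `z`, between `y` and `z`, and before both. Three common-neighbour counts equal `(k - 1) / 2`
and read `a + b + 1`, `b + c + 1` and `a + c + 1`, so `a = b = c` and `k = 4a + 3`. -/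
theorem four_dvd_succ {x y : V} (hxy : Γ.Adj x y) : 4 ∣ k + 1 := by
  have hα : ∀ {x y : V}, Γ.Adj x y → 2 * #{z | Γ.Adj x z ∧ Γ.Adj z y} + 1 = k :=
    fun hxy => h.two_mul_card_between_add_one hσ hinv hw hk hk3 hxy
  have hβ : ∀ {x y : V}, Γ.Adj x y → 2 * #{z | Γ.Adj x z ∧ Γ.Adj y z} + 1 = k := fun hxy => by
    have h1 := h.card_out_eq_add hxy
    have h2 := hα hxy
    rw [hk] at h1
    omega
  obtain ⟨z, hz0⟩ : ∃ z, Γ.Adj x z ∧ Γ.Adj y z := by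
    have := hβ hxy
    obtain ⟨z, hz⟩ := Finset.card_pos.1 (show 0 < #{z | Γ.Adj x z ∧ Γ.Adj y z} by omega)
    exact ⟨z, by simpa using hz⟩
  obtain ⟨hz, hyz⟩ := hz0
  have hout : #{w | Γ.Adj x w ∧ Γ.Adj y w} = #{w | Γ.Adj x w ∧ Γ.Adj y w ∧ Γ.Adj z w} +
      #{w | Γ.Adj x w ∧ Γ.Adj y w ∧ Γ.Adj w z} + 1 := by
    rw [← Finset.card_union_of_disjoint, ← Finset.card_insert_of_notMem (a := z)]
    · congr 1
      ext w
      simp only [Finset.mem_filter, Finset.mem_univ, true_and, Finset.mem_insert,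
        Finset.mem_union]
      constructor
      · rintro ⟨h1, h2⟩
        by_cases hwz : w = z
        · exact Or.inl hwz
        · have := h.out_adj x w z h1 hz hwz
          tauto
      · rintro (rfl | h1 | h1)
        · exact ⟨hz, hyz⟩
        · exact ⟨h1.1, h1.2.1⟩
        · exact ⟨h1.1, h1.2.1⟩
    · simp [h.loopless z]
    · rw [Finset.disjoint_left]
      intro w h1 h2
      simp only [Finset.mem_filter, Finset.mem_univ, true_and] at h1 h2
      exact h.asymm _ _ h1.2.2 h2.2.2
  have hin : #{w | Γ.Adj x w ∧ Γ.Adj w z} = #{w | Γ.Adj x w ∧ Γ.Adj w y ∧ Γ.Adj w z} +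
      #{w | Γ.Adj x w ∧ Γ.Adj y w ∧ Γ.Adj w z} + 1 := by
    rw [← Finset.card_union_of_disjoint, ← Finset.card_insert_of_notMem (a := y)]
    · congr 1
      ext w
      simp only [Finset.mem_filter, Finset.mem_univ, true_and, Finset.mem_insert,
        Finset.mem_union]
      constructor
      · rintro ⟨h1, h2⟩
        by_cases hwy : w = y
        · exact Or.inl hwy
        · have := h.out_adj x w y h1 hxy hwy
          tauto
      · rintro (rfl | h1 | h1)
        · exact ⟨hxy, hyz⟩
        · exact ⟨h1.1, h1.2.2⟩
        · exact ⟨h1.1, h1.2.2⟩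
    · simp [h.loopless y]
    · rw [Finset.disjoint_left]
      intro w h1 h2
      simp only [Finset.mem_filter, Finset.mem_univ, true_and] at h1 h2
      exact h.asymm _ _ h1.2.1 h2.2.1
  have hswap : #{w | Γ.Adj w x ∧ Γ.Adj y w ∧ Γ.Adj z w} =
      #{w | Γ.Adj x w ∧ Γ.Adj w y ∧ Γ.Adj w z} := by
    refine Finset.card_nbij' σ σ (fun w hw => ?_) (fun w hw => ?_) (fun w _ => hinv w)
      (fun w _ => hinv w) <;>
    · simp only [Finset.coe_filter, Finset.mem_univ, true_and, Set.mem_ofPred_eq] at hw ⊢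
      simpa only [hσ.adj_iff, antipode_adj_iff hσ hinv] using hw
  have hboth : #{w | Γ.Adj y w ∧ Γ.Adj z w} = #{w | Γ.Adj x w ∧ Γ.Adj y w ∧ Γ.Adj z w} +
      #{w | Γ.Adj w x ∧ Γ.Adj y w ∧ Γ.Adj z w} + 1 := by
    rw [← Finset.card_union_of_disjoint, ← Finset.card_insert_of_notMem (a := σ x)]
    · congr 1
      ext w
      simp only [Finset.mem_filter, Finset.mem_univ, true_and, Finset.mem_insert,
        Finset.mem_union]
      constructor
      · rintro ⟨h1, h2⟩
        rcases h.eq_or_eq_antipode_or_adj hσ hinv hw.1 x w with rfl | h0 | h0 | h0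
        · exact absurd h1 (h.asymm _ _ hxy)
        all_goals tauto
      · rintro (rfl | h1 | h1)
        · exact ⟨(hσ.adj_iff _ _).2 hxy, (hσ.adj_iff _ _).2 hz⟩
        · exact h1.2
        · exact h1.2
    · simp [h.not_adj_antipode hσ x, hσ.not_adj x]
    · rw [Finset.disjoint_left]
      intro w h1 h2
      simp only [Finset.mem_filter, Finset.mem_univ, true_and] at h1 h2
      exact h.asymm _ _ h1.1 h2.1
  have e1 := hβ hxy
  have e2 := hα hz
  have e3 := hβ hyz
  omega

end Involution

end IsSeparatedLocalTournament

end Digraph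

/-! ### Recognition of team tournaments of type II. -/

namespace Digraph

theorem adjacencyMatrix_sq_apply {V : Type*} [Fintype V] (Γ : Digraph V) (x y : V) :
    (Γ.adjacencyMatrix ^ 2) x y = (#{z | Γ.Adj x z ∧ Γ.Adj z y} : ℤ) := by
  simp [pow_two, Matrix.mul_apply, adjacencyMatrix, ← ite_and, and_comm]

namespace IsSeparatedLocalTournament

variable {V : Type*} [Fintype V] {Γ : Digraph V} {σ : V → V} {k : ℕ}

theorem _root_.exists_fin_fibres {V : Type*} [Finite V] {σ : V → V} (hinv : ∀ x, σ (σ x) = x) :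
    ∃ (r : ℕ) (part : V → Fin r), Function.Surjective part ∧
      ∀ x y, part x = part y ↔ y = x ∨ y = σ x := by
  let s : Setoid V :=
    { r := fun x y => y = x ∨ y = σ x
      iseqv :=
        { refl := fun x => Or.inl rfl
          symm := by
            rintro x y (rfl | rfl)
            · exact Or.inl rfl
            · exact Or.inr (hinv x).symm
          trans := by
            rintro x y z (rfl | rfl) (rfl | rfl)
            · exact Or.inl rfl
            · exact Or.inr rfl
            · exact Or.inr rfl
            · exact Or.inl (hinv x) } }
  obtain ⟨r, ⟨e⟩⟩ := Finite.exists_equiv_fin (Quotient s)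
  refine ⟨r, fun x => e (Quotient.mk s x), e.surjective.comp Quotient.mk_surjective,
    fun x y => ?_⟩
  rw [e.apply_eq_iff_eq, Quotient.eq]
  rfl

theorem exists_typeII (h : Γ.IsSeparatedLocalTournament) (hσ : Γ.IsAntipodal σ)
    (hinv : ∀ x, σ (σ x) = x) (hw : Γ.IsWeaklyDistanceRegular)
    (hk : ∀ x, #{z | Γ.Adj x z} = k) (hk3 : 3 ≤ k) {x₀ y₀ : V} (h₀ : Γ.Adj x₀ y₀) :
    ∃ r, 0 < r ∧ 4 ∣ r ∧ Γ.IsDoublyRegularTeamTournamentTypeII r 2 := by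
  obtain ⟨r, part, hsurj, hpart⟩ := exists_fin_fibres hinv
  have hjoin : ∀ x y, part x ≠ part y → Γ.Adj x y ∨ Γ.Adj y x := fun x y hxy => by
    rw [Ne, hpart] at hxy
    have := h.eq_or_eq_antipode_or_adj hσ hinv hw.1 x y
    tauto
  have hnot : ∀ x y, part x = part y → ¬ Γ.Adj x y := fun x y hxy => by
    rcases (hpart x y).1 hxy with rfl | rfl
    · exact h.loopless _
    · exact h.not_adj_antipode hσ x
  have hfib : ∀ y, part ⁻¹' {part y} = {y, σ y} := fun y => by
    ext z
    simp only [Set.mem_preimage, Set.mem_singleton_iff, Set.mem_insert_iff]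
    rw [eq_comm, hpart]
  have hfibcard : ∀ i, (part ⁻¹' {i}).ncard = 2 := fun i => by
    obtain ⟨y, rfl⟩ := hsurj i
    rw [hfib, Set.ncard_pair (hσ.ne y).symm]
  have hcard : Fintype.card V = 2 * r := by
    have h1 := Finset.card_eq_sum_card_fiberwise (s := (Finset.univ : Finset V))
      (t := Finset.univ) (f := part) (fun _ _ => by simp)
    have h2 : ∀ i, #{z | part z = i} = 2 := fun i => by
      convert (ncard_setOf_eq_card (fun z => part z = i)).symm.trans (hfibcard i)
    simp only [h2, Finset.card_univ, Finset.sum_const, Fintype.card_fin, smul_eq_mul] at h1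
    omega
  have hcard' : Fintype.card V = 2 * k + 2 := by
    refine le_antisymm ?_ (h.two_mul_add_two_le_card hσ hw hk x₀)
    have h1 : (Finset.univ : Finset V) ⊆ {x₀, σ x₀} ∪
        (({z | Γ.Adj x₀ z} : Finset V) ∪ ({z | Γ.Adj z x₀} : Finset V)) := fun y _ => by
      have := h.eq_or_eq_antipode_or_adj hσ hinv hw.1 x₀ y
      simp only [Finset.mem_union, Finset.mem_insert, Finset.mem_singleton, Finset.mem_filter,
        Finset.mem_univ, true_and]
      tauto
    have h2 := Finset.card_le_card h1
    have h3 := Finset.card_union_le ({x₀, σ x₀} : Finset V)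
      (({z | Γ.Adj x₀ z} : Finset V) ∪ ({z | Γ.Adj z x₀} : Finset V))
    have h4 := Finset.card_union_le ({z | Γ.Adj x₀ z} : Finset V) ({z | Γ.Adj z x₀} : Finset V)
    have h5 : #({x₀, σ x₀} : Finset V) ≤ 2 := Finset.card_le_two
    rw [hw.card_in_eq_out h.loopless x₀ x₀, hk] at h4
    rw [Finset.card_univ] at h2
    omega
  have hr : r = k + 1 := by omega
  have hα : ∀ {x y : V}, Γ.Adj x y → 2 * #{z | Γ.Adj x z ∧ Γ.Adj z y} + 1 = k :=
    fun hxy => h.two_mul_card_between_add_one hσ hinv hw hk hk3 hxy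
  set α := #{z | Γ.Adj x₀ z ∧ Γ.Adj z y₀} with hα₀
  have hα₁ := hα h₀
  -- Here `γ = k` because every out-neighbour of `x` lies between `x` and `σ x`, and `β = α` by the
  -- symmetry under `σ`.
  refine ⟨r, by omega, hr ▸ h.four_dvd_succ hσ hinv hw hk hk3 h₀, part, α, α, k,
    ⟨⟨hfibcard, hnot, fun x y hxy => ?_⟩, ⟨k, fun x => ⟨?_, ?_⟩⟩, ?_⟩, sub_self _, even_two, ?_⟩
  · rcases hjoin x y hxy with h1 | h1
    · exact Or.inl ⟨h1, h.asymm _ _ h1⟩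
    · exact Or.inr ⟨h1, h.asymm _ _ h1⟩
  · rw [outNbhd, ncard_setOf_eq_card, hk]
  · rw [inNbhd, ncard_setOf_eq_card, hw.card_in_eq_out h.loopless x x, hk]
  · ext x y
    have hA : ∀ a b, Γ.adjacencyMatrix a b = if Γ.Adj a b then 1 else 0 := fun _ _ => rfl
    rw [adjacencyMatrix_sq_apply]
    simp only [Matrix.add_apply, Matrix.smul_apply, Matrix.sub_apply, Matrix.transpose_apply,
      Matrix.of_apply, smul_eq_mul, hA, Matrix.one_apply]
    rcases h.eq_or_eq_antipode_or_adj hσ hinv hw.1 x y with rfl | rfl | h1 | h1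
    · have : #{z | Γ.Adj y z ∧ Γ.Adj z y} = 0 := by
        rw [Finset.card_eq_zero, Finset.filter_eq_empty_iff]
        exact fun z _ hz => h.asymm _ _ hz.1 hz.2
      rw [this]
      simp [h.loopless y]
    · simp [hσ.adj_iff, hk, h.loopless x, antipode_adj_iff hσ hinv, (hσ.ne x).symm]
    · have e1 := hα h1
      have : #{z | Γ.Adj x z ∧ Γ.Adj z y} = α := by omega
      simp [this, h1, h.asymm _ _ h1, h.ne_of_adj h1]
    · have e1 := hα h1
      have : #{z | Γ.Adj x z ∧ Γ.Adj z y} = α := by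
        rw [card_between_eq_card_back hσ hinv]
        omega
      simp [this, h1, h.asymm _ _ h1, (h.ne_of_adj h1).symm]
  · intro x i hxi
    obtain ⟨y, rfl⟩ := hsurj i
    rw [hfib]
    refine Set.ncard_eq_one.2 ?_
    rcases hjoin x y hxi with h1 | h1
    · refine ⟨y, Set.ext fun z => ⟨?_, ?_⟩⟩
      · rintro ⟨hz, rfl | rfl⟩
        · rfl
        · exact absurd ((hσ.adj_iff _ _).1 hz) (h.asymm _ _ h1)
      · rintro rfl
        exact ⟨h1, Or.inl rfl⟩
    · refine ⟨σ y, Set.ext fun z => ⟨?_, ?_⟩⟩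
      · rintro ⟨hz, rfl | rfl⟩
        · exact absurd hz (h.asymm _ _ h1)
        · rfl
      · rintro rfl
        exact ⟨(hσ.adj_iff _ _).2 h1, Or.inr rfl⟩

end IsSeparatedLocalTournament

/-! ### Valencies one and two: Cayley digraphs of cyclic groups. -/

section Cycle

variable {V : Type*} [Finite V] {Γ : Digraph V} {τ : V → V}

/-- By strong connectivity every vertex is an iterate of a periodic point under `τ`, so `τ` is a
single cycle through all vertices. -/
theorem exists_iso_addCayley [Nonempty V] (hc : Γ.IsStronglyConnected) (i : ℕ)
    (hτ : ∀ x y, Γ.Adj x y ↔ y = τ x ∨ y = τ^[i] x) :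
    Nonempty (Γ.Iso (addCayley ({1, (i : ZMod (Nat.card V))} : Set (ZMod (Nat.card V))))) ∧
      ∀ x, Function.minimalPeriod τ x = Nat.card V := by
  obtain ⟨x₀, hper⟩ : ∃ x₀, x₀ ∈ Function.periodicPts τ := by
    obtain ⟨x⟩ := ‹Nonempty V›
    obtain ⟨a, b, hab, he⟩ := Finite.exists_ne_map_eq_of_infinite (fun j : ℕ => τ^[j] x)
    wlog hlt : a < b generalizing a b
    · exact this b a hab.symm he.symm (by omega)
    refine ⟨τ^[a] x, Function.mk_mem_periodicPts (n := b - a) (by omega) ?_⟩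
    rw [Function.IsPeriodicPt, Function.IsFixedPt, ← Function.iterate_add_apply,
      Nat.sub_add_cancel hlt.le]
    exact he.symm
  have horb : ∀ y, ∃ j, τ^[j] x₀ = y := hc.forall_of_closed (x := x₀) ⟨0, rfl⟩ (by
    rintro _ z ⟨j, rfl⟩ hz
    rcases (hτ _ _).1 hz with rfl | rfl
    · exact ⟨j + 1, Function.iterate_succ_apply' _ _ _⟩
    · exact ⟨i + j, Function.iterate_add_apply _ _ _ _⟩)
  obtain ⟨n, hn⟩ : ∃ n, Function.minimalPeriod τ x₀ = n := ⟨_, rfl⟩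
  have hpos : 0 < n := hn ▸ Function.minimalPeriod_pos_of_mem_periodicPts hper
  have : NeZero n := ⟨hpos.ne'⟩
  let e : ZMod n → V := fun a => τ^[a.val] x₀
  have he : ∀ j : ℕ, e j = τ^[j] x₀ := fun j => by
    simp only [e, ZMod.val_natCast]
    rw [← hn, Function.iterate_mod_minimalPeriod_eq]
  have hbij : Function.Bijective e := by
    constructor
    · intro a b hab
      refine ZMod.val_injective n (Function.iterate_injOn_Iio_minimalPeriod (f := τ) (x := x₀)
        ?_ ?_ hab)
      · exact hn ▸ a.val_lt
      · exact hn ▸ b.val_lt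
    · intro y
      obtain ⟨j, rfl⟩ := horb y
      exact ⟨j, he j⟩
  have hcard : n = Nat.card V := by
    rw [← Nat.card_congr (Equiv.ofBijective e hbij), Nat.card_zmod]
  have hadd : ∀ (j : ℕ) (a : ZMod n), τ^[j] (e a) = e (a + j) := fun j a => by
    have : (a + j) = ((j + a.val : ℕ) : ZMod n) := by
      rw [Nat.cast_add, ZMod.natCast_zmod_val, add_comm]
    rw [this, he, Function.iterate_add_apply]
  refine ⟨?_, fun x => ?_⟩
  · rw [← hcard]
    refine ⟨RelIso.symm ⟨Equiv.ofBijective e hbij, fun {a b} => ?_⟩⟩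
    have h1 : τ (e a) = e (a + 1) := by simpa using hadd 1 a
    simp only [Equiv.ofBijective_apply, hτ, hadd, h1, hbij.1.eq_iff, addCayley,
      Set.mem_insert_iff, Set.mem_singleton_iff, neg_add_eq_iff_eq_add]
  · obtain ⟨j, rfl⟩ := horb x
    rw [Function.minimalPeriod_apply_iterate hper, hn, hcard]

omit [Finite V] in
theorem hasPath_iff_exists_iterate (hτ : ∀ x y, Γ.Adj x y ↔ y = τ x ∨ y = τ (τ x)) (r : ℕ)
    (x y : V) : Γ.HasPath r x y ↔ ∃ j, r ≤ j ∧ j ≤ 2 * r ∧ y = τ^[j] x := by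
  induction r generalizing x with
  | zero =>
    rw [hasPath_zero_iff]
    constructor
    · rintro rfl
      exact ⟨0, le_rfl, le_rfl, rfl⟩
    · rintro ⟨j, -, hj, rfl⟩
      rw [Nat.le_zero.1 hj]
      rfl
  | succ r ih =>
    simp only [hasPath_succ_iff, ih, hτ]
    constructor
    · rintro ⟨z, rfl | rfl, j, h1, h2, rfl⟩
      · exact ⟨j + 1, by omega, by omega, rfl⟩
      · exact ⟨j + 2, by omega, by omega, rfl⟩
    · rintro ⟨j, h1, h2, rfl⟩
      obtain ⟨j, rfl⟩ : ∃ i, j = i + 1 := ⟨j - 1, by omega⟩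
      by_cases h3 : j ≤ 2 * r
      · exact ⟨τ x, Or.inl rfl, j, by omega, h3, rfl⟩
      · obtain ⟨j, rfl⟩ : ∃ i, j = i + 1 := ⟨j - 1, by omega⟩
        exact ⟨τ (τ x), Or.inr rfl, j, by omega, by omega, rfl⟩

-- The way back has `2m` or `2m - 1` unit steps; jumps of one or two cover either in `m` arcs and no
-- fewer.
omit [Finite V] in
theorem dist_iterate_eq (hc : Γ.IsStronglyConnected)
    (hτ : ∀ x y, Γ.Adj x y ↔ y = τ x ∨ y = τ (τ x)) {m i : ℕ}
    (hm : 1 ≤ m) (hi : i = 1 ∨ i = 2) {x : V}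
    (hp : Function.minimalPeriod τ x = 2 * m + 1) : Γ.dist (τ^[i] x) x = m := by
  refine le_antisymm (dist_le_of_hasPath ?_) ?_
  · refine (hasPath_iff_exists_iterate hτ _ _ _).2 ⟨2 * m + 1 - i, by omega, by omega, ?_⟩
    rw [← Function.iterate_add_apply, Nat.sub_add_cancel (by omega), ← hp]
    exact (Function.iterate_minimalPeriod).symm
  · obtain ⟨j, -, hj, he⟩ := (hasPath_iff_exists_iterate hτ _ _ _).1
      (hc.hasPath_dist (τ^[i] x) x)
    rw [← Function.iterate_add_apply] at he
    have h1 := Function.IsPeriodicPt.minimalPeriod_dvd (f := τ) (x := x) (n := j + i) he.symm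
    rw [hp] at h1
    have := Nat.le_of_dvd (by omega) h1
    omega

-- For odd order, the arcs of lengths one and two have the same two-way distance, but only the
-- longer one has a vertex between its ends.
omit [Finite V] in
theorem even_card_of_iterate [Fintype V] [Nonempty V] (hw : Γ.IsWeaklyDistanceRegular)
    (hasymm : ∀ x y, Γ.Adj x y → ¬ Γ.Adj y x)
    (hτ : ∀ x y, Γ.Adj x y ↔ y = τ x ∨ y = τ (τ x)) (hcard : 2 ≤ Nat.card V)
    (hp : ∀ x, Function.minimalPeriod τ x = Nat.card V) : 2 ∣ Nat.card V := by
  by_contra hodd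
  obtain ⟨m, hm⟩ : ∃ m, Nat.card V = 2 * m + 1 := ⟨Nat.card V / 2, by omega⟩
  have hl : Γ.Loopless := fun x hx => hasymm x x hx hx
  obtain ⟨x⟩ := ‹Nonempty V›
  have hpx := (hp x).trans hm
  have h1 : Γ.Adj x (τ x) := (hτ _ _).2 (Or.inl rfl)
  have h2 : Γ.Adj x (τ (τ x)) := (hτ _ _).2 (Or.inr rfl)
  have h12 : Γ.Adj (τ x) (τ (τ x)) := (hτ _ _).2 (Or.inl rfl)
  have htw : Γ.twoWayDist x (τ x) = Γ.twoWayDist x (τ (τ x)) := by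
    have e1 := dist_iterate_eq hw.1 hτ (by omega) (Or.inl rfl) hpx
    have e2 := dist_iterate_eq hw.1 hτ (by omega) (Or.inr rfl) hpx
    simp only [Function.iterate_succ, Function.iterate_zero, Function.comp, id] at e1 e2
    simp only [twoWayDist, e1, e2, (hw.1.dist_eq_one hl).2 h1, (hw.1.dist_eq_one hl).2 h2]
  have hc := hw.card_between_eq hl htw
  have h3 : 0 < #{z | Γ.Adj x z ∧ Γ.Adj z (τ (τ x))} :=
    Finset.card_pos.2 ⟨τ x, by simpa using ⟨h1, h12⟩⟩
  rw [← hc] at h3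
  obtain ⟨z, hz⟩ := Finset.card_pos.1 h3
  simp only [Finset.mem_filter, Finset.mem_univ, true_and] at hz
  rcases (hτ x z).1 hz.1 with rfl | rfl
  · exact hl _ hz.2
  · exact hasymm _ _ h12 hz.2

end Cycle

/-- The three-cycle in the first alternative is recorded because it later forces the twin classes to
be complete. -/
theorem IsSeparatedLocalTournament.classification {V : Type*} [Fintype V] {Γ : Digraph V}
    (h : Γ.IsSeparatedLocalTournament) (hw : Γ.IsWeaklyDistanceRegular) {x y : V}
    (hxy : Γ.Adj x y) :
    ((∃ z, Γ.Adj y z ∧ Γ.Adj z x) ∧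
      ∃ r, 0 < r ∧ 4 ∣ r ∧ Γ.IsDoublyRegularTeamTournamentTypeII r 2) ∨
    ∃ i l, (i = 1 ∨ i = 2) ∧ 5 - i ≤ l ∧
      Nonempty (Γ.Iso (addCayley ({1, (i : ZMod (i * l))} : Set (ZMod (i * l))))) := by
  have : Nonempty V := ⟨x⟩
  obtain ⟨σ, hσ⟩ := h.exists_isAntipodal hw hxy
  obtain ⟨k, hk0⟩ : ∃ k, #{z | Γ.Adj x z} = k := ⟨_, rfl⟩
  have hk : ∀ x', #{z | Γ.Adj x' z} = k := fun x' => (hw.card_out_eq h.loopless x' x).trans hk0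
  have hpos : 0 < k := hk0 ▸ Finset.card_pos.2 ⟨y, by simpa using hxy⟩
  have hcard := h.two_mul_add_two_le_card hσ hw hk x
  rw [← Nat.card_eq_fintype_card] at hcard
  by_cases hk1 : k = 1
  · right
    obtain ⟨τ, hτ⟩ := exists_map_of_card_eq_one hk hk1
    obtain ⟨hiso, -⟩ := exists_iso_addCayley hw.1 1 (τ := τ) (fun x y => by
      rw [hτ, Function.iterate_one, or_self])
    refine ⟨1, Nat.card V, Or.inl rfl, by omega, ?_⟩
    rw [one_mul]
    exact hiso
  by_cases hk2 : k = 2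
  · right
    obtain ⟨τ, hτ⟩ := h.exists_map_of_card_eq_two hσ hk hk2
    obtain ⟨hiso, hper⟩ := exists_iso_addCayley hw.1 2 hτ
    obtain ⟨l, hl⟩ := even_card_of_iterate hw h.asymm hτ (by omega) hper
    refine ⟨2, l, Or.inr rfl, by omega, ?_⟩
    rw [← hl]
    exact hiso
  left
  have hk3 : 3 ≤ k := by omega
  have htw := h.twoWayDist_antipode_eq hσ hw hk hpos
  have hd : Γ.dist x (σ x) = 2 := (hw.1.dist_eq_two h.loopless).2
    ⟨(hσ.ne x).symm, h.not_adj_antipode hσ x, y, hxy, (hσ.adj_iff _ _).2 hxy⟩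
  have hd2 : Γ.dist (σ x) x = 2 := by
    have h3 : ¬ 3 ≤ Γ.dist (σ x) x := fun h3 => by
      have := h.card_out_le_two_of_three_le hσ hw x (fun y => by
        have := htw y x
        simp only [twoWayDist, Prod.mk.injEq] at this
        exact this.2) h3
      rw [hk] at this
      omega
    have h0 : Γ.dist (σ x) x ≠ 0 := fun h0 => hσ.ne x (hw.1.dist_eq_zero.1 h0)
    have h1 : Γ.dist (σ x) x ≠ 1 := fun h1 => hσ.not_adj x ((hw.1.dist_eq_one h.loopless).1 h1)
    omega
  -- Antipodal pairs have two-way distance `(2, 2)`, which is symmetric, and it characterizes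
  -- antipodes.
  have hinv : ∀ x, σ (σ x) = x := fun z => by
    refine (h.eq_antipode_of_twoWayDist_eq hσ hw hk hpos (x' := x) ?_).symm
    refine (twoWayDist_comm_eq (htw z x)).trans ?_
    simp only [twoWayDist, hd, hd2]
  refine ⟨?_, h.exists_typeII hσ hinv hw hk hk3 hxy⟩
  have h12 := h.twoWayDist_eq_one_two hσ hinv hw hk hk3 hxy
  simp only [twoWayDist, Prod.mk.injEq] at h12
  exact ((hw.1.dist_eq_two h.loopless).1 h12.2).2.2

end Digraph

/-! ### Twins. -/

namespace Digraph

section Twin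

variable {V : Type*} {Γ : Digraph V}

/-- The vertices `x` and `y` are equal or joined by an arc. -/
def Near (Γ : Digraph V) (x y : V) : Prop := x = y ∨ Γ.Adj x y ∨ Γ.Adj y x

/-- The vertices `x` and `y` have the same closed neighbourhood in the underlying graph. -/
def IsTwin (Γ : Digraph V) (x y : V) : Prop := ∀ z, Γ.Near x z ↔ Γ.Near y z

theorem Near.symm {x y : V} (h : Γ.Near x y) : Γ.Near y x := by
  unfold Near at *
  tauto

theorem near_self (x : V) : Γ.Near x x := Or.inl rfl

theorem IsTwin.refl (x : V) : Γ.IsTwin x x := fun _ => Iff.rfl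

theorem IsTwin.symm {x y : V} (h : Γ.IsTwin x y) : Γ.IsTwin y x := fun z => (h z).symm

theorem IsTwin.trans {x y z : V} (h : Γ.IsTwin x y) (h' : Γ.IsTwin y z) : Γ.IsTwin x z :=
  fun w => (h w).trans (h' w)

theorem IsTwin.near {x y : V} (h : Γ.IsTwin x y) : Γ.Near x y := (h y).2 (near_self y)

theorem IsTwin.adj_or_adj {x y : V} (h : Γ.IsTwin x y) (hne : x ≠ y) : Γ.Adj x y ∨ Γ.Adj y x :=
  h.near.resolve_left hne

/-- Being twins as an equivalence relation. -/
def twinSetoid (Γ : Digraph V) : Setoid V where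
  r := Γ.IsTwin
  iseqv := ⟨IsTwin.refl, IsTwin.symm, IsTwin.trans⟩

section LocallySemicomplete

variable (hs : Γ.IsLocallySemicomplete)
include hs

theorem IsLocallySemicomplete.near_out {x y z : V} (hy : Γ.Adj x y) (hz : Γ.Adj x z) :
    Γ.Near y z := by
  by_cases h : y = z
  · exact Or.inl h
  · exact Or.inr ((isLocallySemicomplete_iff.1 hs x y z h).1 hy hz)

theorem IsLocallySemicomplete.near_in {x y z : V} (hy : Γ.Adj y x) (hz : Γ.Adj z x) :
    Γ.Near y z := by
  by_cases h : y = z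
  · exact Or.inl h
  · exact Or.inr ((isLocallySemicomplete_iff.1 hs x y z h).2 hy hz)

theorem IsLocallySemicomplete.isTwin_of_adj_of_adj {x y : V} (h1 : Γ.Adj x y) (h2 : Γ.Adj y x) :
    Γ.IsTwin x y := by
  have key : ∀ {x y z : V}, Γ.Adj x y → Γ.Adj y x → Γ.Near x z → Γ.Near y z := by
    rintro x y z h1 h2 (rfl | h | h)
    · exact Or.inr (Or.inl h2)
    · exact hs.near_out h1 h
    · exact hs.near_in h2 h
  exact fun z => ⟨key h1 h2, key h2 h1⟩

end LocallySemicomplete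

variable [Fintype V]

namespace IsWeaklyDistanceRegular

variable (hw : Γ.IsWeaklyDistanceRegular) (hl : Γ.Loopless)
include hw hl

omit [Fintype V] in
theorem near_iff {x y : V} : Γ.Near x y ↔ Γ.twoWayDist x y = (0, 0) ∨
    (Γ.twoWayDist x y).1 = 1 ∨ (Γ.twoWayDist x y).2 = 1 := by
  rw [hw.1.twoWayDist_eq_zero]
  simp only [twoWayDist, hw.1.dist_eq_one hl, Near]

theorem card_near_eq (x x' : V) : #{z | Γ.Near x z} = #{z | Γ.Near x' z} := by
  simp only [hw.near_iff hl]
  convert hw.card_eq_of_vertex (fun t => t = (0, 0) ∨ t.1 = 1 ∨ t.2 = 1) x x'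

theorem isTwin_of_forall {x y : V} (h : ∀ z, Γ.Near x z → Γ.Near y z) : Γ.IsTwin x y := by
  have heq : ({z | Γ.Near x z} : Finset V) = ({z | Γ.Near y z} : Finset V) := by
    refine Finset.eq_of_subset_of_card_le (fun z hz => ?_) (hw.card_near_eq hl y x).le
    simpa using h z (by simpa using hz)
  intro z
  simpa using Finset.ext_iff.1 heq z

/-- This expresses twinness by a count, and so makes it a function of the two-way distance. -/
theorem isTwin_iff_card {x y : V} :
    Γ.IsTwin x y ↔ #{z | Γ.Near x z ∧ Γ.Near z y} = #{z | Γ.Near x z} := by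
  constructor
  · intro h
    congr 1
    ext z
    simp only [Finset.mem_filter, Finset.mem_univ, true_and, and_iff_left_iff_imp]
    exact fun hz => ((h z).1 hz).symm
  · intro h
    have heq : ({z | Γ.Near x z ∧ Γ.Near z y} : Finset V) = ({z | Γ.Near x z} : Finset V) := by
      refine Finset.eq_of_subset_of_card_le (fun z hz => ?_) h.ge
      simp only [Finset.mem_filter, Finset.mem_univ, true_and] at hz ⊢
      exact hz.1
    refine hw.isTwin_of_forall hl fun z hz => ?_
    have := (Finset.ext_iff.1 heq z).2 (by simpa using hz)
    simp only [Finset.mem_filter, Finset.mem_univ, true_and] at this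
    exact this.2.symm

theorem isTwin_iff_of_twoWayDist_eq {x y x' y' : V}
    (h : Γ.twoWayDist x y = Γ.twoWayDist x' y') : Γ.IsTwin x y ↔ Γ.IsTwin x' y' := by
  rw [hw.isTwin_iff_card hl, hw.isTwin_iff_card hl, hw.card_near_eq hl x x']
  have := hw.card_eq h (fun t => t = (0, 0) ∨ t.1 = 1 ∨ t.2 = 1)
    (fun t => t = (0, 0) ∨ t.1 = 1 ∨ t.2 = 1)
  simp only [← hw.near_iff hl] at this
  rw [this]

theorem isTwin_iff_exists {x y : V} :
    Γ.IsTwin x y ↔ ∃ a b, Γ.IsTwin a b ∧ Γ.twoWayDist a b = Γ.twoWayDist x y :=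
  ⟨fun h => ⟨x, y, h, rfl⟩, fun ⟨_, _, h, he⟩ => (hw.isTwin_iff_of_twoWayDist_eq hl he).1 h⟩

theorem card_isTwin_and_eq (P : ℕ × ℕ → Prop) (x x' : V) :
    #{z | Γ.IsTwin x z ∧ P (Γ.twoWayDist x z)} =
      #{z | Γ.IsTwin x' z ∧ P (Γ.twoWayDist x' z)} := by
  have := hw.card_eq_of_vertex
    (fun t => (∃ a b, Γ.IsTwin a b ∧ Γ.twoWayDist a b = t) ∧ P t) x x'
  simpa only [← hw.isTwin_iff_exists hl] using this

theorem card_isTwin_eq (x x' : V) : #{z | Γ.IsTwin x z} = #{z | Γ.IsTwin x' z} := by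
  simpa using hw.card_isTwin_and_eq hl (fun _ => True) x x'

/-- Twin classes have diameter at most two. -/
theorem exists_isTwin_between {u v : V} (huv : Γ.IsTwin u v) (hne : u ≠ v) (hna : ¬ Γ.Adj u v) :
    ∃ w, Γ.IsTwin u w ∧ Γ.Adj u w ∧ Γ.Adj w v := by
  -- Let `d` and `d'` be the out- and in-valency of a vertex in its class. Semicompleteness bounds
  -- the class size by `1 + d + d'`, whereas `{u, v}`, the out-neighbours of `u` and the
  -- in-neighbours of `v` would be disjoint, giving at least `2 + d + d'`.
  by_contra! hno
  have hin : #{w | Γ.IsTwin u w ∧ Γ.Adj w u} = #{w | Γ.IsTwin v w ∧ Γ.Adj w v} := by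
    have := hw.card_isTwin_and_eq hl (fun t => t.2 = 1) u v
    simpa only [twoWayDist, hw.1.dist_eq_one hl] using this
  have h1 : ({w | Γ.IsTwin u w} : Finset V) ⊆ insert u
      (({w | Γ.IsTwin u w ∧ Γ.Adj u w} : Finset V) ∪
        ({w | Γ.IsTwin u w ∧ Γ.Adj w u} : Finset V)) := by
    intro w hw
    simp only [Finset.mem_insert, Finset.mem_union, Finset.mem_filter, Finset.mem_univ,
      true_and] at hw ⊢
    rcases hw.near with h0 | h0 | h0
    · exact Or.inl h0.symm
    · exact Or.inr (Or.inl ⟨hw, h0⟩)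
    · exact Or.inr (Or.inr ⟨hw, h0⟩)
  have h2 : ({u, v} : Finset V) ∪ (({w | Γ.IsTwin u w ∧ Γ.Adj u w} : Finset V) ∪
        ({w | Γ.IsTwin v w ∧ Γ.Adj w v} : Finset V)) ⊆ ({w | Γ.IsTwin u w} : Finset V) := by
    intro w
    simp only [Finset.mem_insert, Finset.mem_singleton, Finset.mem_union, Finset.mem_filter,
      Finset.mem_univ, true_and]
    rintro ((rfl | rfl) | h0 | h0)
    · exact IsTwin.refl _
    · exact huv
    · exact h0.1
    · exact huv.trans h0.1
  have h3 := (Finset.card_le_card h1).trans (Finset.card_insert_le _ _)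
  have h4 := Finset.card_union_le ({w | Γ.IsTwin u w ∧ Γ.Adj u w} : Finset V)
    ({w | Γ.IsTwin u w ∧ Γ.Adj w u} : Finset V)
  have h5 := Finset.card_le_card h2
  rw [Finset.card_union_of_disjoint, Finset.card_union_of_disjoint, Finset.card_pair hne] at h5
  · omega
  · rw [Finset.disjoint_left]
    intro w h6 h7
    simp only [Finset.mem_filter, Finset.mem_univ, true_and] at h6 h7
    exact hno w h6.1 h6.2 h7.2
  · rw [Finset.disjoint_left]
    intro w h6 h7
    simp only [Finset.mem_insert, Finset.mem_singleton, Finset.mem_union, Finset.mem_filter,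
      Finset.mem_univ, true_and] at h6 h7
    rcases h6 with rfl | rfl
    · exact h7.elim (fun h => hl _ h.2) (fun h => hna h.2)
    · exact h7.elim (fun h => hna h.2) (fun h => hl _ h.2)

variable (hs : Γ.IsLocallySemicomplete)
include hs

/-- In-neighbours of `y` are near `x` anyway; were all out-neighbours near `x` too, equal sizes of
closed neighbourhoods would make `x` and `y` twins. -/
theorem exists_adj_not_near {x y : V} (hxy : Γ.Adj x y) (ht : ¬ Γ.IsTwin x y) :
    ∃ w, Γ.Adj y w ∧ ¬ Γ.Near x w := by
  by_contra! hno
  refine ht (hw.isTwin_of_forall hl (x := y) fun z hz => ?_).symm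
  rcases hz with rfl | h0 | h0
  · exact Or.inr (Or.inl hxy)
  · exact hno z h0
  · exact hs.near_in hxy h0

theorem exists_adj_not_near' {x y : V} (hxy : Γ.Adj x y) (ht : ¬ Γ.IsTwin x y) :
    ∃ w, Γ.Adj w x ∧ ¬ Γ.Near y w := by
  by_contra! hno
  refine ht (hw.isTwin_of_forall hl fun z hz => ?_)
  rcases hz with rfl | h0 | h0
  · exact Or.inr (Or.inr hxy)
  · exact hs.near_out hxy h0
  · exact hno z h0

/-- Take an out-neighbour `w` of `y` that is not near `x`. An arc from `y` to `x'` would bring `x'`,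
hence its twin `x`, near `w`. -/
theorem adj_of_isTwin_left {x y x' : V} (hxy : Γ.Adj x y) (ht : ¬ Γ.IsTwin x y)
    (hx : Γ.IsTwin x x') : Γ.Adj x' y := by
  obtain ⟨w, h1, h2⟩ := hw.exists_adj_not_near hl hs hxy ht
  rcases (hx y).1 (Or.inr (Or.inl hxy)) with h0 | h0 | h0
  · exact absurd (h0 ▸ hx) ht
  · exact h0
  · exact absurd ((hx w).2 (hs.near_out h0 h1)) h2

theorem adj_of_isTwin_right {x y y' : V} (hxy : Γ.Adj x y) (ht : ¬ Γ.IsTwin x y)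
    (hy : Γ.IsTwin y y') : Γ.Adj x y' := by
  obtain ⟨w, h1, h2⟩ := hw.exists_adj_not_near' hl hs hxy ht
  rcases (hy x).1 (Or.inr (Or.inr hxy)) with h0 | h0 | h0
  · exact absurd (h0 ▸ hy.symm) ht
  · exact absurd ((hy w).2 (hs.near_in h0 h1)) h2
  · exact h0

end IsWeaklyDistanceRegular

end Twin

/-- `Δ` is the quotient of `Γ` by the twin relation, without the arcs between twins. -/
structure IsTwinQuotient {V W : Type*} (Γ : Digraph V) (Δ : Digraph W) (f : V → W) : Prop where
  surj : Function.Surjective f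
  eq_iff : ∀ x y, f x = f y ↔ Γ.IsTwin x y
  adj_iff : ∀ x y, Δ.Adj (f x) (f y) ↔ ¬ Γ.IsTwin x y ∧ Γ.Adj x y

/-! ### The twin quotient. -/

namespace IsTwinQuotient

theorem exists_quotient {V : Type u} [Fintype V] {Γ : Digraph V} (hw : Γ.IsWeaklyDistanceRegular)
    (hl : Γ.Loopless) (hs : Γ.IsLocallySemicomplete) :
    ∃ (W : Type u) (_ : Fintype W) (Δ : Digraph W) (f : V → W), Γ.IsTwinQuotient Δ f := by
  refine ⟨Quotient Γ.twinSetoid, Fintype.ofFinite _,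
    ⟨fun a b => ∃ x y, Quotient.mk _ x = a ∧ Quotient.mk _ y = b ∧ ¬ Γ.IsTwin x y ∧ Γ.Adj x y⟩,
    Quotient.mk _, Quotient.mk_surjective, fun x y => Quotient.eq, fun x y => ⟨?_, ?_⟩⟩
  · rintro ⟨x', y', hx, hy, h1, h2⟩
    replace hx : Γ.IsTwin x' x := Quotient.eq.1 hx
    replace hy : Γ.IsTwin y' y := Quotient.eq.1 hy
    have h3 := hw.adj_of_isTwin_left hl hs h2 h1 hx
    have h4 : ¬ Γ.IsTwin x y' := fun h => h1 (hx.trans h)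
    exact ⟨fun h => h4 (h.trans hy.symm), hw.adj_of_isTwin_right hl hs h3 h4 hy⟩
  · rintro ⟨h1, h2⟩
    exact ⟨x, y, rfl, rfl, h1, h2⟩

variable {V W : Type*} {Γ : Digraph V} {Δ : Digraph W} {f : V → W}
variable (hq : Γ.IsTwinQuotient Δ f)
include hq

theorem exists_hasPath_quotient {r : ℕ} {x y : V} (hp : Γ.HasPath r x y) :
    ∃ s ≤ r, Δ.HasPath s (f x) (f y) := by
  induction r generalizing x with
  | zero => exact ⟨0, le_rfl, hasPath_zero_iff.2 (by rw [hasPath_zero_iff.1 hp])⟩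
  | succ r ih =>
    obtain ⟨z, hz, hzy⟩ := hasPath_succ_iff.1 hp
    obtain ⟨s, hs, hsp⟩ := ih hzy
    by_cases ht : Γ.IsTwin x z
    · exact ⟨s, by omega, (hq.eq_iff x z).2 ht ▸ hsp⟩
    · exact ⟨s + 1, by omega, hasPath_succ_iff.2 ⟨f z, (hq.adj_iff x z).2 ⟨ht, hz⟩, hsp⟩⟩

/-- Arcs of `Δ` lift to arbitrary representatives. Positive length matters: a path of length zero
only says that the ends are twins. -/
theorem hasPath_of_quotient {r : ℕ} {x y : V} (hp : Δ.HasPath (r + 1) (f x) (f y)) :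
    Γ.HasPath (r + 1) x y := by
  induction r generalizing x with
  | zero =>
    rw [hasPath_one_iff] at hp ⊢
    exact ((hq.adj_iff x y).1 hp).2
  | succ r ih =>
    obtain ⟨c, hc, hcy⟩ := hasPath_succ_iff.1 hp
    obtain ⟨z, rfl⟩ := hq.surj c
    exact hasPath_succ_iff.2 ⟨z, ((hq.adj_iff x z).1 hc).2, ih hcy⟩

theorem isStronglyConnected (hc : Γ.IsStronglyConnected) : Δ.IsStronglyConnected := by
  intro a b
  obtain ⟨x, rfl⟩ := hq.surj a
  obtain ⟨y, rfl⟩ := hq.surj b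
  obtain ⟨r, hr⟩ := hc x y
  obtain ⟨s, -, hs⟩ := hq.exists_hasPath_quotient hr
  exact ⟨s, hs⟩

theorem dist_eq (hc : Γ.IsStronglyConnected) {x y : V} (ht : ¬ Γ.IsTwin x y) :
    Δ.dist (f x) (f y) = Γ.dist x y := by
  have hc' := hq.isStronglyConnected hc
  apply le_antisymm
  · obtain ⟨s, hs, hsp⟩ := hq.exists_hasPath_quotient (hc.hasPath_dist x y)
    exact (dist_le_of_hasPath hsp).trans hs
  · obtain ⟨n, hn⟩ : ∃ n, Δ.dist (f x) (f y) = n + 1 := Nat.exists_eq_succ_of_ne_zero fun h0 =>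
      ht ((hq.eq_iff x y).1 (hc'.dist_eq_zero.1 h0))
    rw [hn]
    refine dist_le_of_hasPath (hq.hasPath_of_quotient ?_)
    rw [← hn]
    exact hc'.hasPath_dist _ _

theorem twoWayDist_eq (hc : Γ.IsStronglyConnected) {x y : V} (ht : ¬ Γ.IsTwin x y) :
    Δ.twoWayDist (f x) (f y) = Γ.twoWayDist x y := by
  rw [twoWayDist, hq.dist_eq hc ht, hq.dist_eq hc fun h => ht h.symm, twoWayDist]

variable [Fintype V] (hl : Γ.Loopless) (hw : Γ.IsWeaklyDistanceRegular)
include hl hw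

theorem card_preimage_eq [Fintype W] (x₀ : V) (p : W → Prop) :
    #{z | p (f z)} = #{c | p c} * #{z | Γ.IsTwin x₀ z} := by
  rw [Finset.card_eq_sum_card_fiberwise (f := f) (t := ({c | p c} : Finset W))
    (fun z hz => by simpa using hz), Finset.sum_congr rfl (g := fun _ => #{z | Γ.IsTwin x₀ z})]
  · simp
  · intro c hc
    obtain ⟨x, rfl⟩ := hq.surj c
    rw [hw.card_isTwin_eq hl x₀ x]
    congr 1
    ext z
    simp only [Finset.mem_filter, Finset.mem_univ, true_and] at hc ⊢
    constructor
    · exact fun h => (hq.eq_iff x z).1 h.2.symm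
    · intro h
      have := (hq.eq_iff x z).2 h
      exact ⟨this ▸ hc, this.symm⟩

theorem isWeaklyDistanceRegular [Fintype W] : Δ.IsWeaklyDistanceRegular := by
  have hc := hw.1
  refine ⟨hq.isStronglyConnected hc, ?_⟩
  have hrep : ∀ a b, ∃ x y, f x = a ∧ f y = b ∧ Γ.twoWayDist x y = Δ.twoWayDist a b := by
    intro a b
    by_cases hab : a = b
    · obtain ⟨x, rfl⟩ := hq.surj a
      exact ⟨x, x, rfl, hab, by rw [hab, twoWayDist_self, twoWayDist_self]⟩
    · obtain ⟨x, rfl⟩ := hq.surj a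
      obtain ⟨y, rfl⟩ := hq.surj b
      exact ⟨x, y, rfl, rfl, (hq.twoWayDist_eq hc fun h => hab ((hq.eq_iff x y).2 h)).symm⟩
  -- Two-way distances of twins collapse to `(0, 0)` and the others persist, so counts in `Δ` are
  -- counts in `Γ` divided by the common class size.
  let g : ℕ × ℕ → ℕ × ℕ := fun t =>
    if ∃ a b, Γ.IsTwin a b ∧ Γ.twoWayDist a b = t then (0, 0) else t
  have hg : ∀ x y, Δ.twoWayDist (f x) (f y) = g (Γ.twoWayDist x y) := fun x y => by
    by_cases ht : Γ.IsTwin x y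
    · rw [(hq.eq_iff x y).2 ht, twoWayDist_self]
      exact (if_pos ((hw.isTwin_iff_exists hl).1 ht)).symm
    · rw [hq.twoWayDist_eq hc ht]
      exact (if_neg fun h => ht ((hw.isTwin_iff_exists hl).2 h)).symm
  rintro _ ⟨a, b, rfl⟩ i - j -
  refine ⟨{z | Δ.twoWayDist a z = i ∧ Δ.twoWayDist z b = j}.ncard, fun a' b' hab => ?_⟩
  obtain ⟨x, y, rfl, rfl, hxy⟩ := hrep a b
  obtain ⟨x', y', rfl, rfl, hxy'⟩ := hrep a' b'
  have hcount := hw.card_eq (hxy'.trans (hab.trans hxy.symm)) (fun t => g t = i)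
    (fun t => g t = j)
  simp only [← hg] at hcount
  have hpos : 0 < #{z | Γ.IsTwin x z} :=
    Finset.card_pos.2 ⟨x, by simpa using IsTwin.refl x⟩
  rw [ncard_setOf_eq_card, ncard_setOf_eq_card]
  refine Nat.eq_of_mul_eq_mul_right hpos ?_
  rw [← hq.card_preimage_eq hl hw, ← hq.card_preimage_eq hl hw]
  convert hcount

theorem isSeparatedLocalTournament (hs : Γ.IsLocallySemicomplete) :
    Δ.IsSeparatedLocalTournament where
  asymm a b hab hba := by
    obtain ⟨x, rfl⟩ := hq.surj a
    obtain ⟨y, rfl⟩ := hq.surj b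
    obtain ⟨h1, h2⟩ := (hq.adj_iff _ _).1 hab
    exact h1 (hs.isTwin_of_adj_of_adj h2 ((hq.adj_iff _ _).1 hba).2)
  out_adj a b c hab hac hbc := by
    obtain ⟨x, rfl⟩ := hq.surj a
    obtain ⟨y, rfl⟩ := hq.surj b
    obtain ⟨z, rfl⟩ := hq.surj c
    have ht : ¬ Γ.IsTwin y z := fun h => hbc ((hq.eq_iff _ _).2 h)
    rcases hs.near_out ((hq.adj_iff _ _).1 hab).2 ((hq.adj_iff _ _).1 hac).2 with rfl | h0 | h0
    · exact absurd rfl hbc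
    · exact Or.inl ((hq.adj_iff _ _).2 ⟨ht, h0⟩)
    · exact Or.inr ((hq.adj_iff _ _).2 ⟨fun h => ht h.symm, h0⟩)
  in_adj a b c hab hac hbc := by
    obtain ⟨x, rfl⟩ := hq.surj a
    obtain ⟨y, rfl⟩ := hq.surj b
    obtain ⟨z, rfl⟩ := hq.surj c
    have ht : ¬ Γ.IsTwin y z := fun h => hbc ((hq.eq_iff _ _).2 h)
    rcases hs.near_in ((hq.adj_iff _ _).1 hab).2 ((hq.adj_iff _ _).1 hac).2 with rfl | h0 | h0
    · exact absurd rfl hbc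
    · exact Or.inl ((hq.adj_iff _ _).2 ⟨ht, h0⟩)
    · exact Or.inr ((hq.adj_iff _ _).2 ⟨fun h => ht h.symm, h0⟩)
  sep a b hab := by
    obtain ⟨x, rfl⟩ := hq.surj a
    obtain ⟨y, rfl⟩ := hq.surj b
    obtain ⟨h1, h2⟩ := (hq.adj_iff _ _).1 hab
    obtain ⟨w, h3, h4⟩ := hw.exists_adj_not_near hl hs h2 h1
    refine ⟨f w, (hq.adj_iff _ _).2 ⟨fun h => h4 ((h x).1 (Or.inr (Or.inr h2))).symm, h3⟩,
      fun h => h4 (Or.inr (Or.inl ((hq.adj_iff _ _).1 h).2)),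
      fun h => h4 (Or.inr (Or.inr ((hq.adj_iff _ _).1 h).2)),
      fun h => h4 ((hq.eq_iff _ _).1 h).near.symm⟩

-- Without arcs in the quotient, strong connectivity leaves a single twin class, which is
-- semicomplete.
omit [Fintype V] hl in
theorem exists_adj (hns : ¬ Γ.IsSemicomplete) : ∃ x y, Δ.Adj (f x) (f y) := by
  by_contra! hno
  refine hns fun x y hxy => ?_
  have : Γ.IsTwin x y := hw.1.forall_of_closed (x := x) (S := Γ.IsTwin x) (IsTwin.refl x)
    (fun y z hy hyz => by
      have := hno y z
      rw [hq.adj_iff, not_and, imp_not_comm, not_not] at this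
      exact hy.trans (this hyz)) y
  exact this.adj_or_adj hxy

end IsTwinQuotient

end Digraph

/-! ### Generalized lexicographic products and isomorphisms. -/

namespace Digraph

section GenLex

variable {W : Type*} {F F' : W → Type*} {Δ : Digraph W} {S : ∀ w, Digraph (F w)}
  {S' : ∀ w, Digraph (F' w)}

theorem genLex_adj_of_ne {p q : Σ w, F w} (h : p.1 ≠ q.1) :
    (Δ.genLex S).Adj p q ↔ Δ.Adj p.1 q.1 :=
  ⟨fun hpq => (Sigma.lex_iff.1 hpq).resolve_right fun ⟨h', _⟩ => h h',
    fun hpq => Sigma.lex_iff.2 (Or.inl hpq)⟩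

theorem genLex_adj_mk_iff (hl : Δ.Loopless) {w : W} {u v : F w} :
    (Δ.genLex S).Adj ⟨w, u⟩ ⟨w, v⟩ ↔ (S w).Adj u v := by
  constructor
  · intro h
    obtain ⟨_, h0⟩ := (Sigma.lex_iff.1 h).resolve_left (hl w)
    exact h0
  · exact fun h => Sigma.Lex.right u v h

/-- Isomorphic factors give isomorphic generalized lexicographic products. -/
def genLexCongr (hl : Δ.Loopless) (e : ∀ w, (S w).Iso (S' w)) :
    (Δ.genLex S).Iso (Δ.genLex S') where
  toEquiv := Equiv.sigmaCongrRight fun w => (e w).toEquiv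
  map_rel_iff' := by
    rintro ⟨w, u⟩ ⟨w', v⟩
    by_cases h : w = w'
    · subst h
      simp only [Equiv.sigmaCongrRight_apply, genLex_adj_mk_iff hl]
      exact (e w).map_rel_iff
    · rw [genLex_adj_of_ne h, genLex_adj_of_ne (by exact h)]
      rfl

theorem genLex_isLocallySemicomplete (hl : Δ.Loopless) (hΔ : Δ.IsLocallySemicomplete)
    (hS : ∀ w, (S w).IsSemicomplete) : (Δ.genLex S).IsLocallySemicomplete := by
  rw [isLocallySemicomplete_iff] at hΔ ⊢
  rintro ⟨x, u⟩ ⟨y, v⟩ ⟨z, w⟩ hne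
  by_cases hyz : y = z
  · subst hyz
    have := hS y v w (fun h => hne (h ▸ rfl))
    simp only [genLex_adj_mk_iff hl]
    exact ⟨fun _ _ => this, fun _ _ => this⟩
  · rw [genLex_adj_of_ne (p := ⟨y, v⟩) (q := ⟨z, w⟩) hyz,
      genLex_adj_of_ne (p := ⟨z, w⟩) (q := ⟨y, v⟩) (Ne.symm hyz)]
    by_cases hxy : x = y
    · subst hxy
      rw [genLex_adj_of_ne (p := ⟨x, u⟩) (q := ⟨z, w⟩) hyz,
        genLex_adj_of_ne (p := ⟨z, w⟩) (q := ⟨x, u⟩) (Ne.symm hyz)]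
      tauto
    · by_cases hxz : x = z
      · subst hxz
        rw [genLex_adj_of_ne (p := ⟨x, u⟩) (q := ⟨y, v⟩) hxy,
          genLex_adj_of_ne (p := ⟨y, v⟩) (q := ⟨x, u⟩) (Ne.symm hxy)]
        tauto
      · rw [genLex_adj_of_ne (p := ⟨x, u⟩) (q := ⟨y, v⟩) hxy,
          genLex_adj_of_ne (p := ⟨y, v⟩) (q := ⟨x, u⟩) (Ne.symm hxy),
          genLex_adj_of_ne (p := ⟨x, u⟩) (q := ⟨z, w⟩) hxz,
          genLex_adj_of_ne (p := ⟨z, w⟩) (q := ⟨x, u⟩) (Ne.symm hxz)]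
        exact hΔ x y z hyz

theorem genLex_not_isSemicomplete (hΔ : ¬ Δ.IsSemicomplete) (hF : ∀ w, Nonempty (F w)) :
    ¬ (Δ.genLex S).IsSemicomplete := by
  refine fun h => hΔ fun x y hxy => ?_
  obtain ⟨u⟩ := hF x
  obtain ⟨v⟩ := hF y
  have := h ⟨x, u⟩ ⟨y, v⟩ (fun h0 => hxy (congrArg Sigma.fst h0))
  rwa [genLex_adj_of_ne (p := ⟨x, u⟩) (q := ⟨y, v⟩) hxy,
    genLex_adj_of_ne (p := ⟨y, v⟩) (q := ⟨x, u⟩) (Ne.symm hxy)] at this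

theorem completeLoopless_isSemicomplete (V : Type*) : (completeLoopless V).IsSemicomplete :=
  fun _ _ h => Or.inl h

end GenLex

section Iso

variable {V W : Type*} {Γ : Digraph V} {Δ : Digraph W}

theorem IsSemicomplete.of_iso (e : Γ.Iso Δ) (h : Γ.IsSemicomplete) : Δ.IsSemicomplete := by
  intro x y hxy
  have := h (e.symm x) (e.symm y) (e.symm.injective.ne hxy)
  rwa [e.symm.map_rel_iff, e.symm.map_rel_iff] at this

theorem IsLocallySemicomplete.of_iso (e : Γ.Iso Δ) (h : Γ.IsLocallySemicomplete) :
    Δ.IsLocallySemicomplete := by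
  rw [isLocallySemicomplete_iff] at h ⊢
  intro x y z hyz
  have := h (e.symm x) (e.symm y) (e.symm z) (e.symm.injective.ne hyz)
  simpa only [e.symm.map_rel_iff] using this

theorem Iso.loopless (e : Γ.Iso Δ) (h : Γ.Loopless) : Δ.Loopless := fun x hx =>
  h (e.symm x) (e.symm.map_rel_iff.2 hx)

end Iso

/-! ### The product decomposition and its twin classes. -/

namespace IsTwinQuotient

variable {V W : Type*} {Γ : Digraph V} {Δ : Digraph W} {f : V → W}

theorem comp_iso (hq : Γ.IsTwinQuotient Δ f) {W' : Type*} {Δ' : Digraph W'} (e : Δ.Iso Δ') :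
    Γ.IsTwinQuotient Δ' (e ∘ f) where
  surj := e.surjective.comp hq.surj
  eq_iff x y := by rw [← hq.eq_iff, Function.comp, Function.comp, e.injective.eq_iff]
  adj_iff x y := by rw [← hq.adj_iff, Function.comp, Function.comp, e.map_rel_iff]

variable (hq : Γ.IsTwinQuotient Δ f)
include hq

theorem loopless : Δ.Loopless := fun w hw => by
  obtain ⟨x, rfl⟩ := hq.surj w
  exact ((hq.adj_iff x x).1 hw).1 (IsTwin.refl x)

theorem nonempty_iso_genLex :
    Nonempty (Γ.Iso (Δ.genLex fun w => Γ.induce {x | f x = w})) := by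
  refine ⟨⟨⟨fun x => ⟨f x, x, rfl⟩, fun p => p.2.1, fun x => rfl, ?_⟩, ?_⟩⟩
  · rintro ⟨w, x, hx⟩
    cases hx
    rfl
  · intro x y
    have key : ∀ w (h : f x = w) (u : {z | f z = w}), (Δ.genLex fun w => Γ.induce {x | f x = w}).Adj
        ⟨w, ⟨x, h⟩⟩ ⟨w, u⟩ ↔ Γ.Adj x u := fun w h u => genLex_adj_mk_iff hq.loopless
    by_cases hxy : f x = f y
    · have h1 := key (f y) hxy ⟨y, rfl⟩
      -- The type of the second component depends on the first, so the point over `f x` is first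
      -- moved to the fibre over `f y`.
      have h2 : (⟨f x, ⟨x, rfl⟩⟩ : Σ w, {z | f z = w}) = ⟨f y, ⟨x, hxy⟩⟩ := by
        generalize_proofs a
        revert a
        rw [hxy]
        intro a
        rfl
      simp only [Equiv.coe_fn_mk]
      rw [h2]
      exact h1
    · simp only [Equiv.coe_fn_mk]
      rw [genLex_adj_of_ne (by exact hxy)]
      simp only [hq.adj_iff]
      rw [hq.eq_iff] at hxy
      tauto

variable [Fintype V] (hl : Γ.Loopless) (hw : Γ.IsWeaklyDistanceRegular)
include hl hw

theorem nonempty_iso_lex (hcomp : ∀ x y, Γ.IsTwin x y → x ≠ y → Γ.Adj x y) (x₀ : V) :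
    Nonempty (Γ.Iso (Δ.lex (completeLoopless (Fin #{z | Γ.IsTwin x₀ z})))) := by
  obtain ⟨e⟩ := hq.nonempty_iso_genLex
  have hcard : ∀ w, Nat.card {x | f x = w} = #{z | Γ.IsTwin x₀ z} := fun w => by
    obtain ⟨x, rfl⟩ := hq.surj w
    rw [hw.card_isTwin_eq hl x₀ x, Nat.card_coe_set_eq, ncard_setOf_eq_card]
    congr 1
    ext z
    simp only [Finset.mem_filter, Finset.mem_univ, true_and]
    rw [eq_comm, hq.eq_iff]
  have e' : ∀ w, (Γ.induce {x | f x = w}).Iso (completeLoopless (Fin #{z | Γ.IsTwin x₀ z})) :=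
    fun w => ⟨Finite.equivFinOfCardEq (hcard w), fun {x y} => by
      change _ ≠ _ ↔ Γ.Adj x y
      rw [(Equiv.injective _).ne_iff]
      constructor
      · intro hne
        exact hcomp x y ((hq.eq_iff _ _).1 (x.2.trans y.2.symm))
          fun h => hne (Subtype.ext h)
      · rintro hxy rfl
        exact hl _ hxy⟩
  exact ⟨e.trans (genLexCongr hq.loopless e')⟩

section Fibre

variable (w : W)

theorem exists_between_induce (u v : {x | f x = w}) (hne : u ≠ v) (hna : ¬ Γ.Adj u v) :
    ∃ z : {x | f x = w}, Γ.Adj u z ∧ Γ.Adj z v := by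
  have ht : Γ.IsTwin u v := (hq.eq_iff _ _).1 (u.2.trans v.2.symm)
  obtain ⟨z, h1, h2, h3⟩ := hw.exists_isTwin_between hl ht (fun h => hne (Subtype.ext h)) hna
  exact ⟨⟨z, ((hq.eq_iff _ _).2 h1).symm.trans u.2⟩, h2, h3⟩

theorem isStronglyConnected_induce : (Γ.induce {x | f x = w}).IsStronglyConnected := by
  intro u v
  by_cases hne : u = v
  · exact ⟨0, hasPath_zero_iff.2 hne⟩
  · by_cases ha : Γ.Adj u v
    · exact ⟨1, hasPath_one_iff.2 ha⟩
    · obtain ⟨z, h1, h2⟩ := hq.exists_between_induce hl hw w u v hne ha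
      exact ⟨2, hasPath_succ_iff.2 ⟨z, h1, hasPath_one_iff.2 h2⟩⟩

omit hq hw [Fintype V] in
theorem loopless_induce : (Γ.induce {x | f x = w}).Loopless := fun x => hl x.1

/-- A shortest path of length two between twins can be chosen inside their class, so classes are
isometric in `Γ`. -/
theorem dist_induce_eq (u v : {x | f x = w}) :
    (Γ.induce {x | f x = w}).dist u v = Γ.dist u v ∧ Γ.dist u v ≤ 2 := by
  have hc := hq.isStronglyConnected_induce hl hw w
  have hl' := loopless_induce (f := f) hl w
  by_cases hne : u = v
  · rw [hne, dist_self, dist_self]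
    exact ⟨rfl, by omega⟩
  · by_cases ha : Γ.Adj u v
    · rw [(hc.dist_eq_one hl').2 ha, (hw.1.dist_eq_one hl).2 ha]
      exact ⟨rfl, by omega⟩
    · obtain ⟨z, h1, h2⟩ := hq.exists_between_induce hl hw w u v hne ha
      rw [(hc.dist_eq_two hl').2 ⟨hne, ha, z, h1, h2⟩,
        (hw.1.dist_eq_two hl).2 ⟨fun h => hne (Subtype.ext h), ha, z, h1, h2⟩]
      exact ⟨rfl, le_rfl⟩

theorem twoWayDist_induce_eq (u v : {x | f x = w}) :
    (Γ.induce {x | f x = w}).twoWayDist u v = Γ.twoWayDist u v := by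
  rw [twoWayDist, twoWayDist, (hq.dist_induce_eq hl hw w u v).1,
    (hq.dist_induce_eq hl hw w v u).1]

theorem exists_induce_twoWayDist_eq {x y : V} (ht : Γ.IsTwin x y) (u : {x | f x = w}) :
    ∃ v : {x | f x = w}, Γ.twoWayDist u v = Γ.twoWayDist x y := by
  obtain ⟨z, hz⟩ := hw.exists_twoWayDist_eq x y u
  have := (hw.isTwin_iff_of_twoWayDist_eq hl hz).2 ht
  exact ⟨⟨z, ((hq.eq_iff _ _).2 this).symm.trans u.2⟩, hz⟩

theorem twoWayDistSet_induce_eq : (Γ.induce {x | f x = w}).twoWayDistSet =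
    {t | ∃ x y, Γ.IsTwin x y ∧ Γ.twoWayDist x y = t} := by
  ext t
  constructor
  · rintro ⟨u, v, rfl⟩
    exact ⟨u, v, (hq.eq_iff _ _).1 (u.2.trans v.2.symm),
      (hq.twoWayDist_induce_eq hl hw w u v).symm⟩
  · rintro ⟨x, y, ht, rfl⟩
    obtain ⟨u, hu⟩ := hq.surj w
    obtain ⟨v, hv⟩ := hq.exists_induce_twoWayDist_eq hl hw w ht ⟨u, hu⟩
    exact ⟨⟨u, hu⟩, v, (hq.twoWayDist_induce_eq hl hw w _ _).trans hv⟩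

/-- A vertex at a twin distance from `u` already lies in the class of `u`, so nothing is lost by
counting in `Γ`; the numbers therefore do not depend on the class. -/
theorem isIntersectionNumber_induce_iff {h i j : ℕ × ℕ} {p : ℕ}
    (hh : h ∈ (Γ.induce {x | f x = w}).twoWayDistSet)
    (hi : i ∈ (Γ.induce {x | f x = w}).twoWayDistSet)
    (hj : j ∈ (Γ.induce {x | f x = w}).twoWayDistSet) :
    (Γ.induce {x | f x = w}).IsIntersectionNumber h i j p ↔ Γ.IsIntersectionNumber h i j p := by
  have hset := hq.twoWayDistSet_induce_eq hl hw w
  have hcount : ∀ u v : {x | f x = w},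
      {z | (Γ.induce {x | f x = w}).twoWayDist u z = i ∧
        (Γ.induce {x | f x = w}).twoWayDist z v = j}.ncard =
      {z | Γ.twoWayDist u z = i ∧ Γ.twoWayDist z v = j}.ncard := fun u v => by
    rw [← Set.ncard_image_of_injective _ Subtype.val_injective]
    congr 1
    ext z
    constructor
    · rintro ⟨z, ⟨h1, h2⟩, rfl⟩
      rw [hq.twoWayDist_induce_eq hl hw] at h1 h2
      exact ⟨h1, h2⟩
    · rintro ⟨h1, h2⟩
      rw [hset] at hi
      have ht : Γ.IsTwin u z := (hw.isTwin_iff_exists hl).2 (by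
        obtain ⟨a, b, hab, he⟩ := hi
        exact ⟨a, b, hab, he.trans h1.symm⟩)
      refine ⟨⟨z, ((hq.eq_iff _ _).2 ht).symm.trans u.2⟩, ⟨?_, ?_⟩, rfl⟩
      · rw [hq.twoWayDist_induce_eq hl hw]
        exact h1
      · rw [hq.twoWayDist_induce_eq hl hw]
        exact h2
  have hmem : ∀ t ∈ (Γ.induce {x | f x = w}).twoWayDistSet, t ∈ Γ.twoWayDistSet := by
    intro t ht
    rw [hset] at ht
    obtain ⟨a, b, -, he⟩ := ht
    exact ⟨a, b, he⟩
  constructor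
  · intro hp x y hxy
    obtain ⟨q, hq'⟩ := hw.2 h (hmem h hh) i (hmem i hi) j (hmem j hj)
    obtain ⟨u, v, huv⟩ := hh
    rw [hq' x y hxy, ← hp u v huv, hcount, hq' u v]
    rw [← hq.twoWayDist_induce_eq hl hw]
    exact huv
  · intro hp u v huv
    rw [hcount]
    exact hp u v ((hq.twoWayDist_induce_eq hl hw w u v).symm.trans huv)

theorem isWeaklyDistanceRegular_induce : (Γ.induce {x | f x = w}).IsWeaklyDistanceRegular := by
  refine ⟨hq.isStronglyConnected_induce hl hw w, fun h hh i hi j hj => ?_⟩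
  have hset := hq.twoWayDistSet_induce_eq hl hw w
  have hmem : ∀ t ∈ (Γ.induce {x | f x = w}).twoWayDistSet, t ∈ Γ.twoWayDistSet := by
    intro t ht
    rw [hset] at ht
    obtain ⟨a, b, -, he⟩ := ht
    exact ⟨a, b, he⟩
  obtain ⟨p, hp⟩ := hw.2 h (hmem h hh) i (hmem i hi) j (hmem j hj)
  exact ⟨p, (hq.isIntersectionNumber_induce_iff hl hw w hh hi hj).2 hp⟩

theorem sameIntersectionNumbers_induce (w' : W) :
    (Γ.induce {x | f x = w}).SameIntersectionNumbers (Γ.induce {x | f x = w'}) := by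
  have hset := hq.twoWayDistSet_induce_eq hl hw
  refine ⟨(hset w).trans (hset w').symm, fun h hh i hi j hj p => ?_⟩
  rw [hq.isIntersectionNumber_induce_iff hl hw w hh hi hj]
  have hs := (hset w).trans (hset w').symm
  rw [hs] at hh hi hj
  rw [hq.isIntersectionNumber_induce_iff hl hw w' hh hi hj]

omit [Fintype V] hl hw in
theorem isSemicomplete_induce : (Γ.induce {x | f x = w}).IsSemicomplete := fun u v hne =>
  ((hq.eq_iff _ _).1 (u.2.trans v.2.symm)).adj_or_adj fun h => hne (Subtype.ext h)

theorem hasDiameter_induce {x y : V} (ht : Γ.IsTwin x y) (hne : x ≠ y) (hna : ¬ Γ.Adj x y) :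
    (Γ.induce {x | f x = w}).HasDiameter 2 := by
  constructor
  · obtain ⟨u, hu⟩ := hq.surj w
    obtain ⟨v, hv⟩ := hq.exists_induce_twoWayDist_eq hl hw w ht ⟨u, hu⟩
    refine ⟨⟨u, hu⟩, v, ?_⟩
    rw [(hq.dist_induce_eq hl hw w _ _).1]
    have h1 : Γ.dist u v = Γ.dist x y := congrArg Prod.fst hv
    obtain ⟨z, -, h2, h3⟩ := hw.exists_isTwin_between hl ht hne hna
    exact h1.trans ((hw.1.dist_eq_two hl).2 ⟨hne, hna, z, h2, h3⟩)
  · rintro n ⟨u, v, rfl⟩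
    have := hq.dist_induce_eq hl hw w u v
    exact this.1.le.trans this.2

end Fibre

/-- The quotient has no three-cycles if some twins are joined by one arc only. -/
theorem not_adj_of_adj_of_adj (hs : Γ.IsLocallySemicomplete) {x y : V} (ht : Γ.IsTwin x y)
    (hne : x ≠ y) (hna : ¬ Γ.Adj x y) {a b c : W} (hab : Δ.Adj a b) (hbc : Δ.Adj b c) :
    ¬ Δ.Adj c a := by
  intro hca
  obtain ⟨u, rfl⟩ := hq.surj a
  obtain ⟨v, rfl⟩ := hq.surj b
  obtain ⟨z, rfl⟩ := hq.surj c
  rw [hq.adj_iff] at hab hbc hca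
  obtain ⟨s, -, h2, h3⟩ := hw.exists_isTwin_between hl ht hne hna
  have hvu : ¬ Γ.Adj v u := fun h => hab.1 (hs.isTwin_of_adj_of_adj hab.2 h)
  have hyx : Γ.Adj y x := (ht.adj_or_adj hne).resolve_left hna
  have hvu' : v ≠ u := by
    rintro rfl
    exact hl _ hab.2
  -- An arc on a three-cycle has two-way distance `(1, 2)`, and so does a one-way arc between twins.
  have h4 : Γ.twoWayDist u v = Γ.twoWayDist y x := by
    rw [twoWayDist, twoWayDist, (hw.1.dist_eq_one hl).2 hab.2, (hw.1.dist_eq_one hl).2 hyx,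
      (hw.1.dist_eq_two hl).2 ⟨hvu', hvu, z, hbc.2, hca.2⟩,
      (hw.1.dist_eq_two hl).2 ⟨hne, hna, s, h2, h3⟩]
  exact hab.1 ((hw.isTwin_iff_of_twoWayDist_eq hl h4).2 ht.symm)

end IsTwinQuotient

end Digraph

/-! ### The listed digraphs are locally semicomplete and not semicomplete. -/

namespace Digraph

namespace IsDoublyRegularTeamTournamentTypeII

variable {V : Type*} [Fintype V] {Γ : Digraph V} {r : ℕ}
variable (h : Γ.IsDoublyRegularTeamTournamentTypeII r 2)
include h

theorem loopless : Γ.Loopless := by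
  obtain ⟨part, α, β, γ, h, -⟩ := h
  exact fun x => h.isTeamTournament.not_adj x x rfl

theorem not_isSemicomplete (hr : 0 < r) : ¬ Γ.IsSemicomplete := by
  obtain ⟨part, α, β, γ, h, -⟩ := h
  obtain ⟨x, y, hxy, hs⟩ := Set.ncard_eq_two.1 (h.isTeamTournament.ncard_fibre ⟨0, hr⟩)
  have hx : x ∈ part ⁻¹' {⟨0, hr⟩} := hs ▸ Set.mem_insert x {y}
  have hy : y ∈ part ⁻¹' {⟨0, hr⟩} := hs ▸ Set.mem_insert_of_mem x rfl
  have hp : part x = part y := Eq.trans hx (Eq.symm hy)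
  exact fun hsc => (hsc x y hxy).elim (h.isTeamTournament.not_adj x y hp)
    (h.isTeamTournament.not_adj y x hp.symm)

/-- Only two vertices of one part could fail to be joined, and since `m / 2 = 1`, a vertex outside a
part has exactly one out-neighbour and one in-neighbour in it. -/
theorem isLocallySemicomplete : Γ.IsLocallySemicomplete := by
  obtain ⟨part, α, β, γ, h, -, -, hII⟩ := h
  obtain ⟨hfib, hnot, hxor⟩ := h.isTeamTournament
  rw [isLocallySemicomplete_iff]
  intro x y z hyz
  have hjoin : part y ≠ part z → Γ.Adj y z ∨ Γ.Adj z y := fun hp =>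
    (hxor y z hp).imp And.left And.left
  by_cases hp : part y = part z
  · have hx : ∀ w, Γ.Adj x w ∨ Γ.Adj w x → part x ≠ part w := fun w hw hp =>
      hw.elim (hnot x w hp) (hnot w x hp.symm)
    constructor
    · intro hxy hxz
      have h1 := hII x (part y) (hx y (Or.inl hxy))
      obtain ⟨w, hw⟩ := Set.ncard_eq_one.1 h1
      have h2 : y ∈ ({w} : Set V) := hw ▸ ⟨hxy, rfl⟩
      have h3 : z ∈ ({w} : Set V) := hw ▸ ⟨hxz, hp.symm⟩
      exact absurd (Eq.trans h2 (Eq.symm h3)) hyz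
    · intro hyx hzx
      have hxp := hx y (Or.inr hyx)
      obtain ⟨w, hw⟩ := Set.ncard_eq_one.1 (hII x (part y) hxp)
      obtain ⟨hxw, hwp⟩ : w ∈ Γ.outNbhd x ∩ part ⁻¹' {part y} := hw ▸ rfl
      have hsub : ({y, z} : Set V) = part ⁻¹' {part y} := by
        refine Set.eq_of_subset_of_ncard_le ?_ ?_
        · rintro u (rfl | rfl)
          · rfl
          · exact hp.symm
        · rw [hfib, Set.ncard_pair hyz]
      rw [← hsub] at hwp
      have hasymm : ∀ u, Γ.Adj u x → ¬ Γ.Adj x u := fun u hu hu' => by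
        rcases hxor x u (hx u (Or.inl hu')) with h0 | h0
        · exact h0.2 hu
        · exact h0.2 hu'
      rcases hwp with rfl | rfl
      · exact absurd hxw (hasymm _ hyx)
      · exact absurd hxw (hasymm _ hzx)
  · exact ⟨fun _ _ => hjoin hp, fun _ _ => hjoin hp⟩

end IsDoublyRegularTeamTournamentTypeII

section Cayley

theorem addCayley_adj_iff {n i : ℕ} {x y : ZMod n} :
    (addCayley ({1, (i : ZMod n)} : Set (ZMod n))).Adj x y ↔ y = x + 1 ∨ y = x + i := by
  simp only [addCayley, Set.mem_insert_iff, Set.mem_singleton_iff, neg_add_eq_iff_eq_add]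

variable {n i : ℕ} (hi : i = 1 ∨ i = 2)
include hi

theorem addCayley_loopless (hn : 2 * i + 2 ≤ n) :
    (addCayley ({1, (i : ZMod n)} : Set (ZMod n))).Loopless := by
  intro x hx
  have key : ∀ j : ℕ, 0 < j → j < n → x ≠ x + j := fun j h0 h1 h => by
    have h2 : (j : ZMod n) = 0 := by simpa using h
    rw [ZMod.natCast_eq_zero_iff] at h2
    exact absurd (Nat.le_of_dvd h0 h2) (by omega)
  rcases addCayley_adj_iff.1 hx with h | h
  · exact key 1 (by omega) (by omega) (by simpa using h)
  · exact key i (by omega) (by omega) h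

theorem addCayley_isLocallySemicomplete :
    (addCayley ({1, (i : ZMod n)} : Set (ZMod n))).IsLocallySemicomplete := by
  rw [isLocallySemicomplete_iff]
  intro x y z hyz
  simp only [addCayley_adj_iff]
  constructor
  · rintro (rfl | rfl) (rfl | rfl)
    · exact absurd rfl hyz
    · rcases hi with rfl | rfl
      · simp at hyz
      · exact Or.inl (Or.inl (by push_cast; ring))
    · rcases hi with rfl | rfl
      · simp at hyz
      · exact Or.inr (Or.inl (by push_cast; ring))
    · exact absurd rfl hyz
  · rintro (rfl | rfl) (h | h)
    · exact absurd (by simpa using h) hyz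
    · rcases hi with rfl | rfl
      · exact absurd (by simpa using h) hyz
      · refine Or.inr (Or.inl ?_)
        have h' : y + 1 = (z + 1) + 1 := by rw [h]; push_cast; ring
        exact add_right_cancel h'
    · rcases hi with rfl | rfl
      · exact absurd (by simpa using h) hyz
      · refine Or.inl (Or.inl ?_)
        have h' : z + 1 = (y + 1) + 1 := by rw [← h]; push_cast; ring
        exact add_right_cancel h'
    · exact absurd (add_right_cancel h) hyz

theorem addCayley_not_isSemicomplete (hn : 2 * i + 2 ≤ n) :
    ¬ (addCayley ({1, (i : ZMod n)} : Set (ZMod n))).IsSemicomplete := by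
  have key : ∀ j : ℕ, 0 < j → j < n → (j : ZMod n) ≠ 0 := fun j h0 h1 h2 => by
    rw [ZMod.natCast_eq_zero_iff] at h2
    exact absurd (Nat.le_of_dvd h0 h2) (by omega)
  intro h
  -- The vertices `0` and `i + 1` are not joined, because `1`, `i`, `i + 2` and `2i + 1` are all
  -- nonzero modulo `n`.
  have h0 : ((i + 1 : ℕ) : ZMod n) ≠ 0 := key _ (by omega) (by omega)
  rcases h 0 _ h0.symm with h1 | h1
  · rcases addCayley_adj_iff.1 h1 with h2 | h2
    · exact key i (by omega) (by omega) (by simpa using h2)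
    · exact key 1 (by omega) (by omega) (by simpa using h2)
  · rcases addCayley_adj_iff.1 h1 with h2 | h2
    · exact key (i + 2) (by omega) (by omega) (by rw [h2]; push_cast; ring)
    · exact key (2 * i + 1) (by omega) (by omega) (by rw [h2]; push_cast; ring)

end Cayley

theorem isLocallySemicomplete_of_iso_genLex {V W : Type*} {Γ : Digraph V} {Δ : Digraph W}
    {F : W → Type*} {S : ∀ w, Digraph (F w)} (hl : Δ.Loopless) (hΔ : Δ.IsLocallySemicomplete)
    (hΔ' : ¬ Δ.IsSemicomplete) (hS : ∀ w, (S w).IsSemicomplete) (hF : ∀ w, Nonempty (F w))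
    (e : Γ.Iso (Δ.genLex S)) : Γ.IsLocallySemicomplete ∧ ¬ Γ.IsSemicomplete :=
  ⟨(genLex_isLocallySemicomplete hl hΔ hS).of_iso e.symm,
    fun h => genLex_not_isSemicomplete hΔ' hF (h.of_iso e)⟩

end Digraph

open Digraph

/-! ### The classification. -/

theorem theorem1p1 {V : Type u} [Fintype V] [Nonempty V] (Γ : Digraph V) (hloop : Γ.Loopless)
    (hwdr : Γ.IsWeaklyDistanceRegular) (hcomm : Γ.IsCommutative) :
    (Γ.IsLocallySemicomplete ∧ ¬ Γ.IsSemicomplete) ↔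
      ((∃ (r m : ℕ) (W : Type u) (_ : Fintype W) (Λ : Digraph W),
          0 < r ∧ 4 ∣ r ∧ 1 ≤ m ∧ Λ.IsDoublyRegularTeamTournamentTypeII r 2 ∧
          Nonempty (Γ.Iso (Λ.lex (Digraph.completeLoopless (Fin m))))) ∨
       (∃ i l m : ℕ, (i = 1 ∨ i = 2) ∧ 5 - i ≤ l ∧ 1 ≤ m ∧
          Nonempty (Γ.Iso ((Digraph.addCayley ({1, (i : ZMod (i * l))} : Set (ZMod (i * l)))).lex
            (Digraph.completeLoopless (Fin m))))) ∨
       (∃ (i q : ℕ) (F : ZMod (i * q) → Type u) (S : ∀ x, Digraph (F x)),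
          (i = 1 ∨ i = 2) ∧ 4 ≤ q ∧
          (∀ x, Finite (F x) ∧ (S x).Loopless ∧ (S x).IsSemicomplete ∧
            (S x).IsWeaklyDistanceRegular ∧ (S x).HasDiameter 2 ∧
            (S 0).SameIntersectionNumbers (S x)) ∧
          Nonempty (Γ.Iso
            ((Digraph.addCayley ({1, (i : ZMod (i * q))} : Set (ZMod (i * q)))).genLex S)))) := by
  constructor
  · rintro ⟨hs, hns⟩
    obtain ⟨W, _, Δ, f, hq⟩ := IsTwinQuotient.exists_quotient hwdr hloop hs
    obtain ⟨x, y, hxy⟩ := hq.exists_adj hwdr hns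
    have hm : 1 ≤ #{z | Γ.IsTwin x z} :=
      Finset.card_pos.2 ⟨x, by simpa using IsTwin.refl x⟩
    rcases (hq.isSeparatedLocalTournament hloop hwdr hs).classification
      (hq.isWeaklyDistanceRegular hloop hwdr) hxy with
      ⟨⟨z, hyz, hzx⟩, r, hr, hr4, hII⟩ | ⟨i, l, hi, hl, ⟨e⟩⟩
    · refine Or.inl ⟨r, _, W, inferInstance, Δ, hr, hr4, hm, hII,
        hq.nonempty_iso_lex hloop hwdr (fun a b hab hne => ?_) x⟩
      by_contra hna
      exact hq.not_adj_of_adj_of_adj hloop hwdr hs hab hne hna hxy hyz hzx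
    · have hq' := hq.comp_iso e
      by_cases hcomp : ∀ x y, Γ.IsTwin x y → x ≠ y → Γ.Adj x y
      · exact Or.inr (Or.inl ⟨i, l, _, hi, hl, hm, hq'.nonempty_iso_lex hloop hwdr hcomp x⟩)
      · push Not at hcomp
        obtain ⟨a, b, hab, hne, hna⟩ := hcomp
        -- For `i = 2` and `l = 3` the vertices `0, 2, 4` form a three-cycle, which incomplete twin
        -- classes forbid.
        have hl4 : 4 ≤ l := by
          rcases hi with rfl | rfl
          · exact hl
          · by_contra hlt
            obtain rfl : l = 3 := by omega
            refine hq'.not_adj_of_adj_of_adj hloop hwdr hs hab hne hna (a := 0) (b := 2) (c := 4)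
              ?_ ?_ ?_ <;>
            · rw [addCayley_adj_iff]
              decide
        exact Or.inr (Or.inr ⟨i, l, fun w => {x | (e ∘ f) x = w}, fun w => Γ.induce _, hi, hl4,
          fun w => ⟨inferInstance, IsTwinQuotient.loopless_induce hloop w,
            hq'.isSemicomplete_induce w, hq'.isWeaklyDistanceRegular_induce hloop hwdr w,
            hq'.hasDiameter_induce hloop hwdr w hab hne hna,
            hq'.sameIntersectionNumbers_induce hloop hwdr 0 w⟩, hq'.nonempty_iso_genLex⟩)
  · have hFin : ∀ m, 1 ≤ m → Nonempty (Fin m) := fun m hm => ⟨⟨0, hm⟩⟩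
    rintro (⟨r, m, W, _, Λ, hr, -, hm, hII, ⟨e⟩⟩ | ⟨i, l, m, hi, hl, hm, ⟨e⟩⟩ |
      ⟨i, q, F, S, hi, hq, hS, ⟨e⟩⟩)
    · exact isLocallySemicomplete_of_iso_genLex hII.loopless hII.isLocallySemicomplete
        (hII.not_isSemicomplete hr) (fun _ => completeLoopless_isSemicomplete _)
        (fun _ => hFin m hm) e
    · have hn : 2 * i + 2 ≤ i * l := by
        rcases hi with rfl | rfl <;> omega
      exact isLocallySemicomplete_of_iso_genLex (addCayley_loopless hi hn)
        (addCayley_isLocallySemicomplete hi) (addCayley_not_isSemicomplete hi hn)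
        (fun _ => completeLoopless_isSemicomplete _) (fun _ => hFin m hm) e
    · have hn : 2 * i + 2 ≤ i * q := by
        rcases hi with rfl | rfl <;> omega
      refine isLocallySemicomplete_of_iso_genLex (addCayley_loopless hi hn)
        (addCayley_isLocallySemicomplete hi) (addCayley_not_isSemicomplete hi hn)
        (fun w => (hS w).2.2.1) (fun w => ?_) e
      -- The diameter is attained, so the factor has a vertex.
      obtain ⟨u, -⟩ := (hS w).2.2.2.2.1.1
      exact ⟨u⟩
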